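/- Let $\mathsf A$ and $\mathsf B$ be square matrices with entries in $\mathbb N=\{0,1,2,\dots\}$, indexed by sets $V$ and $W$ respectively, and essential, i.e. without zero rows and without zero columns. For a $V\times W$ matrix $\mathsf F$ over $\mathbb N$ let $E_{\mathsf F}=\{(v,\alpha,w): v\in V,\ w\in W,\ 0\le\alpha<\mathsf F_{vw}\}$ with source $s(v,\alpha,w)=v$ and range $r(v,\alpha,w)=w$. Products of such edge sets are fibered products: $E_{\mathsf F}\times E_{\mathsf G}=\{(e,f): r(e)=s(f)\}$, and so on for more factors (bracketings are identified, $E_{\mathsf A}\times E_{\mathsf A}^m=E_{\mathsf A}^{m+1}=E_{\mathsf A}^m\times E_{\mathsf A}$); the source of a path is that of its first edge and its range is that of its last edge. A path isomorphism is a bijection between two such products that preserves source and range. For a positive integer $m$, a concrete shift between $\mathsf A$ and $\mathsf B$ with lag $m$ is a tuple $(\mathsf R,\mathsf S,\varphi_{\mathsf R},\varphi_{\mathsf S},\psi_{\mathsf A},\psi_{\mathsf B})$ of a $V\times W$ matrix $\mathsf R$ and a $W\times V$ matrix $\mathsf S$ over $\mathbb N$ and path isomorphisms $$\varphi_{\mathsf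 R}\colon E_{\mathsf A}\times E_{\mathsf R}\to E_{\mathsf R}\times E_{\mathsf B},\quad \varphi_{\mathsf S}\colon E_{\mathsf B}\times E_{\mathsf S}\to E_{\mathsf S}\times E_{\mathsf A},\quad \psi_{\mathsf A}\colon E_{\mathsf R}\times E_{\mathsf S}\to E_{\mathsf A}^m,\quad \psi_{\mathsf B}\colon E_{\mathsf S}\times E_{\mathsf R}\to E_{\mathsf B}^m .$$ Put $\varphi_{\mathsf R}^{(m)}=(\varphi_{\mathsf R}\times\mathrm{id}_{\mathsf B^{m-1}})(\mathrm{id}_{\mathsf A}\times\varphi_{\mathsf R}\times\mathrm{id}_{\mathsf B^{m-2}})\cdots(\mathrm{id}_{\mathsf A^{m-1}}\times\varphi_{\mathsf R})\colon E_{\mathsf A}^m\times E_{\mathsf R}\to E_{\mathsf R}\times E_{\mathsf B}^m$, and define $\varphi_{\mathsf S}^{(m)}$ likewise. The concrete shift is - aligned if $(\psi_{\mathsf A}\times\mathrm{id}_{\mathsf A})(\mathrm{id}_{\mathsf R}\times\varphi_{\mathsf S})(\varphi_{\mathsf R}\times\mathrm{id}_{\mathsf S})=\mathrm{id}_{\mathsf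 A}\times\psi_{\mathsf A}$ and $(\psi_{\mathsf B}\times\mathrm{id}_{\mathsf B})(\mathrm{id}_{\mathsf S}\times\varphi_{\mathsf R})(\varphi_{\mathsf S}\times\mathrm{id}_{\mathsf R})=\mathrm{id}_{\mathsf B}\times\psi_{\mathsf B}$; - balanced if $\psi_{\mathsf A}^{-1}\times\psi_{\mathsf A}=(\mathrm{id}_{\mathsf R}\times\varphi_{\mathsf S}^{(m)})(\varphi_{\mathsf R}^{(m)}\times\mathrm{id}_{\mathsf S})$ and $\psi_{\mathsf B}^{-1}\times\psi_{\mathsf B}=(\mathrm{id}_{\mathsf S}\times\varphi_{\mathsf R}^{(m)})(\varphi_{\mathsf S}^{(m)}\times\mathrm{id}_{\mathsf R})$; - compatible if $\varphi_{\mathsf R}^{(m)}=(\mathrm{id}_{\mathsf R}\times\psi_{\mathsf B})(\psi_{\mathsf A}^{-1}\times\mathrm{id}_{\mathsf R})$ and $\varphi_{\mathsf S}^{(m)}=(\mathrm{id}_{\mathsf S}\times\psi_{\mathsf A})(\psi_{\mathsf B}^{-1}\times\mathrm{id}_{\mathsf S})$. $\mathsf A$ and $\mathsf B$ are aligned (balanced,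 compatible) shift equivalent with lag $m$ if there is an aligned (balanced, compatible) concrete shift between them with lag $m$, and aligned (balanced, compatible) shift equivalent if this holds for some $m\ge1$. For finite index sets, $\mathsf A$ and $\mathsf B$ are strong shift equivalent (SSE) if for some $m\ge 1$ there are finite matrices $\mathsf R_1,\dots,\mathsf R_m$, $\mathsf S_1,\dots,\mathsf S_m$ over $\mathbb N$ with $\mathsf A=\mathsf R_1\mathsf S_1$, $\mathsf S_i\mathsf R_i=\mathsf R_{i+1}\mathsf S_{i+1}$ for $1\le i<m$, and $\mathsf S_m\mathsf R_m=\mathsf B$. **Theorem.** (1) For every positive integer $m$ the following are equivalent: $\mathsf A$ and $\mathsf B$ are aligned shift equivalent with lag $m$; they are balanced shift equivalent with lag $m$; they are compatible shift equivalent with lag $m$. (2) If moreover $V$ and $W$ are finite, then each of aligned, balanced and compatible shift equivalence of $\mathsf A$ and $\mathsf B$ is equivalent to strong shift equivalence of $\mathsf A$ and $\mathsf B$. -/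

import Mathlib

universe u

namespace ShiftEq

/-- A set of edges (or paths) with source map into `V` and range map into `W`. -/
structure EdgeSet (V W : Type u) where
  carrier : Type u
  s : carrier → V
  r : carrier → W

/-- The elements `(v, α, w)` with `0 ≤ α < F v w`. -/
structure Edge {V W : Type u} (F : Matrix V W ℕ) : Type u where
  src : V
  rng : W
  idx : Fin (F src rng)

/-- The edge set `E_F` of a matrix `F`. -/
def E {V W : Type u} (F : Matrix V W ℕ) : EdgeSet V W where
  carrier := Edge F
  s := Edge.src
  r := Edge.rng

/-- The fibered product: pairs `(e, f)` with `r e = s f`. -/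
def fib {U V W : Type u} (P : EdgeSet U V) (Q : EdgeSet V W) : EdgeSet U W where
  carrier := {p : P.carrier × Q.carrier // P.r p.1 = Q.s p.2}
  s := fun p => P.s p.1.1
  r := fun p => Q.r p.1.2

/-- The paths of length zero: one at each vertex. -/
def vertices (V : Type u) : EdgeSet V V where
  carrier := V
  s := id
  r := id

/-- The `n`-fold fibered product of `P` with itself, i.e. the paths `e₁ e₂ ⋯ eₙ`. -/
def pow {V : Type u} (P : EdgeSet V V) : ℕ → EdgeSet V V
  | 0 => vertices V
  | n + 1 => fib P (pow P n)

/-- Path isomorphisms: bijections that preserve source and range. -/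
@[ext]
structure PathIso {V W : Type u} (P Q : EdgeSet V W) where
  toEquiv : P.carrier ≃ Q.carrier
  map_s : ∀ x, Q.s (toEquiv x) = P.s x
  map_r : ∀ x, Q.r (toEquiv x) = P.r x

namespace PathIso

/-- The identity path isomorphism. -/
def refl {V W : Type u} (P : EdgeSet V W) : PathIso P P where
  toEquiv := Equiv.refl _
  map_s := fun _ => rfl
  map_r := fun _ => rfl

/-- The inverse path isomorphism. -/
def symm {V W : Type u} {P Q : EdgeSet V W} (f : PathIso P Q) : PathIso Q P where
  toEquiv := f.toEquiv.symm
  map_s := fun x => by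
    have h := f.map_s (f.toEquiv.symm x)
    rw [Equiv.apply_symm_apply] at h
    exact h.symm
  map_r := fun x => by
    have h := f.map_r (f.toEquiv.symm x)
    rw [Equiv.apply_symm_apply] at h
    exact h.symm

/-- The composition "first `f`, then `g`". -/
def trans {V W : Type u} {P Q T : EdgeSet V W} (f : PathIso P Q) (g : PathIso Q T) :
    PathIso P T where
  toEquiv := f.toEquiv.trans g.toEquiv
  map_s := fun x => (g.map_s _).trans (f.map_s x)
  map_r := fun x => (g.map_r _).trans (f.map_r x)

/-- The product `f × g` of path isomorphisms, `(x, y) ↦ (f x, g y)`. -/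
def prod {U V W : Type u} {P P' : EdgeSet U V} {Q Q' : EdgeSet V W}
    (f : PathIso P P') (g : PathIso Q Q') : PathIso (fib P Q) (fib P' Q') where
  toEquiv :=
    { toFun := fun p => ⟨(f.toEquiv p.1.1, g.toEquiv p.1.2), by
        rw [f.map_r, g.map_s]; exact p.2⟩
      invFun := fun p => ⟨(f.symm.toEquiv p.1.1, g.symm.toEquiv p.1.2), by
        rw [f.symm.map_r, g.symm.map_s]; exact p.2⟩
      left_inv := fun p => Subtype.ext
        (Prod.ext (f.toEquiv.symm_apply_apply _) (g.toEquiv.symm_apply_apply _))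
      right_inv := fun p => Subtype.ext
        (Prod.ext (f.toEquiv.apply_symm_apply _) (g.toEquiv.apply_symm_apply _)) }
  map_s := fun p => f.map_s p.1.1
  map_r := fun p => g.map_r p.1.2

/-- Re-bracketing `((x, y), z) ↦ (x, (y, z))`. -/
def assoc {U V W X : Type u} (P : EdgeSet U V) (Q : EdgeSet V W) (T : EdgeSet W X) :
    PathIso (fib (fib P Q) T) (fib P (fib Q T)) where
  toEquiv :=
    { toFun := fun p => ⟨(p.1.1.1.1, ⟨(p.1.1.1.2, p.1.2), p.2⟩), p.1.1.2⟩
      invFun := fun p => ⟨(⟨(p.1.1, p.1.2.1.1), p.2⟩, p.1.2.1.2), p.1.2.2⟩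
      left_inv := fun _ => rfl
      right_inv := fun _ => rfl }
  map_s := fun _ => rfl
  map_r := fun _ => rfl

/-- Removing a path of length zero on the right, `(x, r x) ↦ x`. -/
def rightUnit {V W : Type u} (P : EdgeSet V W) : PathIso (fib P (vertices W)) P where
  toEquiv :=
    { toFun := fun p => p.1.1
      invFun := fun x => ⟨(x, P.r x), rfl⟩
      left_inv := fun p => Subtype.ext (Prod.ext rfl p.2)
      right_inv := fun _ => rfl }
  map_s := fun _ => rfl
  map_r := fun p => p.2

/-- Removing a path of length zero on the left, `(s x, x) ↦ x`. -/
def leftUnit {V W : Type u} (P : EdgeSet V W) : PathIso (fib (vertices V) P) P where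
  toEquiv :=
    { toFun := fun p => p.1.2
      invFun := fun x => ⟨(P.s x, x), rfl⟩
      left_inv := fun p => Subtype.ext (Prod.ext p.2.symm rfl)
      right_inv := fun _ => rfl }
  map_s := fun p => p.2.symm
  map_r := fun _ => rfl

/-- The canonical identification of `P × Pⁿ` with `Pⁿ × P`,
`(e₁, (e₂, …, eₙ₊₁)) ↦ ((e₁, …, eₙ), eₙ₊₁)`. -/
def rebracket {V : Type u} (P : EdgeSet V V) :
    (n : ℕ) → PathIso (fib P (pow P n)) (fib (pow P n) P)
  | 0 => (rightUnit P).trans (leftUnit P).symm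
  | n + 1 => ((refl P).prod (rebracket P n)).trans (assoc P (pow P n) P).symm

/-- For `φ : A × R → R × B`, the path isomorphism `φ⁽ⁿ⁾ : Aⁿ × R → R × Bⁿ`,
`φ⁽ⁿ⁾ = (φ × id) (id_A × φ × id) ⋯ (id × φ)`, moving `R` to the left one edge at a time. -/
def iter {V W : Type u} {A : EdgeSet V V} {B : EdgeSet W W} {R : EdgeSet V W}
    (φ : PathIso (fib A R) (fib R B)) : (n : ℕ) → PathIso (fib (pow A n) R) (fib R (pow B n))
  | 0 => (leftUnit R).trans (rightUnit R).symm
  | n + 1 =>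
    (assoc A (pow A n) R).trans <|
      ((refl A).prod (iter φ n)).trans <|
        (assoc A R (pow B n)).symm.trans <|
          (φ.prod (refl (pow B n))).trans (assoc R B (pow B n))

end PathIso

/-- A matrix is essential if it has no zero row and no zero column. -/
def Essential {V W : Type u} (F : Matrix V W ℕ) : Prop :=
  (∀ v, ∃ w, F v w ≠ 0) ∧ (∀ w, ∃ v, F v w ≠ 0)

/-- A concrete shift `(R, S, φ_R, φ_S, ψ_A, ψ_B)` between `A` and `B` with lag `m`. -/
structure ConcreteShift {V W : Type u} (A : Matrix V V ℕ) (B : Matrix W W ℕ) (m : ℕ) where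
  R : Matrix V W ℕ
  S : Matrix W V ℕ
  φR : PathIso (fib (E A) (E R)) (fib (E R) (E B))
  φS : PathIso (fib (E B) (E S)) (fib (E S) (E A))
  ψA : PathIso (fib (E R) (E S)) (pow (E A) m)
  ψB : PathIso (fib (E S) (E R)) (pow (E B) m)

namespace ConcreteShift

open PathIso

variable {V W : Type u} {A : Matrix V V ℕ} {B : Matrix W W ℕ} {m : ℕ}

/-- `(ψ_A × id_A)(id_R × φ_S)(φ_R × id_S) = id_A × ψ_A` and
`(ψ_B × id_B)(id_S × φ_R)(φ_S × id_R) = id_B × ψ_B`. -/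
def IsAligned (c : ConcreteShift A B m) : Prop :=
  (c.φR.prod (refl (E c.S))).trans
      ((assoc (E c.R) (E B) (E c.S)).trans
        (((refl (E c.R)).prod c.φS).trans
          ((assoc (E c.R) (E c.S) (E A)).symm.trans (c.ψA.prod (refl (E A))))))
    = (assoc (E A) (E c.R) (E c.S)).trans
        (((refl (E A)).prod c.ψA).trans (rebracket (E A) m)) ∧
  (c.φS.prod (refl (E c.R))).trans
      ((assoc (E c.S) (E A) (E c.R)).trans
        (((refl (E c.S)).prod c.φR).trans
          ((assoc (E c.S) (E c.R) (E B)).symm.trans (c.ψB.prod (refl (E B))))))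
    = (assoc (E B) (E c.S) (E c.R)).trans
        (((refl (E B)).prod c.ψB).trans (rebracket (E B) m))

/-- `ψ_A⁻¹ × ψ_A = (id_R × φ_S⁽ᵐ⁾)(φ_R⁽ᵐ⁾ × id_S)` and
`ψ_B⁻¹ × ψ_B = (id_S × φ_R⁽ᵐ⁾)(φ_S⁽ᵐ⁾ × id_R)`. -/
def IsBalanced (c : ConcreteShift A B m) : Prop :=
  (assoc (pow (E A) m) (E c.R) (E c.S)).trans
      ((c.ψA.symm.prod c.ψA).trans (assoc (E c.R) (E c.S) (pow (E A) m)))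
    = ((c.φR.iter m).prod (refl (E c.S))).trans
        ((assoc (E c.R) (pow (E B) m) (E c.S)).trans
          ((refl (E c.R)).prod (c.φS.iter m))) ∧
  (assoc (pow (E B) m) (E c.S) (E c.R)).trans
      ((c.ψB.symm.prod c.ψB).trans (assoc (E c.S) (E c.R) (pow (E B) m)))
    = ((c.φS.iter m).prod (refl (E c.R))).trans
        ((assoc (E c.S) (pow (E A) m) (E c.R)).trans
          ((refl (E c.S)).prod (c.φR.iter m)))

/-- `φ_R⁽ᵐ⁾ = (id_R × ψ_B)(ψ_A⁻¹ × id_R)` and `φ_S⁽ᵐ⁾ = (id_S × ψ_A)(ψ_B⁻¹ × id_S)`. -/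
def IsCompatible (c : ConcreteShift A B m) : Prop :=
  c.φR.iter m
    = (c.ψA.symm.prod (refl (E c.R))).trans
        ((assoc (E c.R) (E c.S) (E c.R)).trans ((refl (E c.R)).prod c.ψB)) ∧
  c.φS.iter m
    = (c.ψB.symm.prod (refl (E c.S))).trans
        ((assoc (E c.S) (E c.R) (E c.S)).trans ((refl (E c.S)).prod c.ψA))

end ConcreteShift

/-- Aligned shift equivalence with lag `m`. -/
def AlignedLag {V W : Type u} (A : Matrix V V ℕ) (B : Matrix W W ℕ) (m : ℕ) : Prop :=
  ∃ c : ConcreteShift A B m, c.IsAligned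

/-- Balanced shift equivalence with lag `m`. -/
def BalancedLag {V W : Type u} (A : Matrix V V ℕ) (B : Matrix W W ℕ) (m : ℕ) : Prop :=
  ∃ c : ConcreteShift A B m, c.IsBalanced

/-- Compatible shift equivalence with lag `m`. -/
def CompatibleLag {V W : Type u} (A : Matrix V V ℕ) (B : Matrix W W ℕ) (m : ℕ) : Prop :=
  ∃ c : ConcreteShift A B m, c.IsCompatible

/-- Aligned shift equivalence (with some positive lag). -/
def Aligned {V W : Type u} (A : Matrix V V ℕ) (B : Matrix W W ℕ) : Prop :=
  ∃ m : ℕ, 0 < m ∧ AlignedLag A B m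

/-- Balanced shift equivalence (with some positive lag). -/
def Balanced {V W : Type u} (A : Matrix V V ℕ) (B : Matrix W W ℕ) : Prop :=
  ∃ m : ℕ, 0 < m ∧ BalancedLag A B m

/-- Compatible shift equivalence (with some positive lag). -/
def Compatible {V W : Type u} (A : Matrix V V ℕ) (B : Matrix W W ℕ) : Prop :=
  ∃ m : ℕ, 0 < m ∧ CompatibleLag A B m

/-- The elementary relation: `A = R S` and `S R = B` for some matrices `R`, `S` over `ℕ`. -/
def ElementarySSE {V W : Type u} [Fintype V] [Fintype W]
    (A : Matrix V V ℕ) (B : Matrix W W ℕ) : Prop :=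
  ∃ (R : Matrix V W ℕ) (S : Matrix W V ℕ), A = R * S ∧ S * R = B

/-- Strong shift equivalence with lag `m`: a chain of `m ≥ 1` elementary relations through
finite square matrices over `ℕ`. -/
inductive SSELag : (m : ℕ) → {V W : Type u} → [Fintype V] → [Fintype W] →
    Matrix V V ℕ → Matrix W W ℕ → Prop
  | single {V W : Type u} [Fintype V] [Fintype W] {A : Matrix V V ℕ} {B : Matrix W W ℕ}
      (h : ElementarySSE A B) : SSELag 1 A B
  | cons {m : ℕ} {V U W : Type u} [Fintype V] [Fintype U] [Fintype W]
      {A : Matrix V V ℕ} {C : Matrix U U ℕ} {B : Matrix W W ℕ}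
      (h : ElementarySSE A C) (t : SSELag m C B) : SSELag (m + 1) A B

/-- Strong shift equivalence. -/
def SSE {V W : Type u} [Fintype V] [Fintype W] (A : Matrix V V ℕ) (B : Matrix W W ℕ) : Prop :=
  ∃ m : ℕ, SSELag m A B

end ShiftEq

/-! Read a composable pair (x, y) in E_R × E_S as naming, through ψ_A, a window of m edges in an
A-path. Alignment says that carrying x and y leftwards across an edge slides this window by one
place: a·ψ_A(x, y) = ψ_A(x', y')·a'. After m slides the window has been replaced completely, so the
old window is the word put out and the new one is the word read in, which is balance
(`HalfAligned.halfBalanced`). Conversely, since no column of A is zero, a path can be extended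
backwards, and balance on overlapping words of length m gives back the single slide
(`HalfBalanced.halfAligned`).

Compatibility gives balance by direct substitution. In the other direction ψ_B has to be replaced:
balance of the A-half alone makes the B-component of φ_R⁽ᵐ⁾(ψ_A(x, y), z) independent of x, and this
component is the new ψ_B(y, z) (`HalfBalanced.exists_halfCompatible`). So an aligned or balanced
first half already yields a compatible shift.

For strong shift equivalence, φ_R makes A act on E_R over its sources and B act on it over its
ranges. The two resulting covers are one graph and its reverse. Compatibility makes words of length
m act as constants on fibres, so at most m amalgamations, each an elementary equivalence, collapse
the covers to A and to the transpose of B (`sse_cover`, `HalfCompatible.sse_adj`). Conversely, A =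
RS and C = SR give an exchange A × R → R × C, and exchanges along a chain compose to a shift with
aligned first half, because both sides of the alignment equation re-bracket the same word
(`HalfAligned.paste`). -/

namespace ShiftEq

open PathIso

/-! ### Paths as lists of edges -/

section Words

variable {V W : Type u}

/-- The list of edges of a path. -/
def word {P : EdgeSet V V} : {n : ℕ} → (pow P n).carrier → List P.carrier
  | 0, _ => []
  | _ + 1, p =>
    let q : (fib P (pow P _)).carrier := p
    q.1.1 :: word q.1.2

theorem word_length {P : EdgeSet V V} : ∀ {n : ℕ} (p : (pow P n).carrier), (word p).length = n
  | 0, _ => rfl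
  | _ + 1, p => congrArg Nat.succ (word_length (P := P) (Subtype.val p).2)

theorem word_injective {P : EdgeSet V V} : ∀ {n : ℕ} {p q : (pow P n).carrier},
    word p = word q → (pow P n).s p = (pow P n).s q → p = q
  | 0, _, _, _, hs => hs
  | n + 1, ⟨(a, p), hp⟩, ⟨(b, q), hq⟩, hw, _ => by
    obtain ⟨rfl, hw'⟩ : a = b ∧ word p = word q := List.cons.inj hw
    obtain rfl : p = q := word_injective hw' (hp.symm.trans hq)
    rfl

/-- Paths of length zero all have the empty word, so the word alone fixes the path only when a first
edge is there to supply the source. -/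
theorem word_injective_of_pos {P : EdgeSet V V} {n : ℕ} (hn : 0 < n) {p q : (pow P n).carrier}
    (h : word p = word q) : p = q := by
  obtain ⟨n, rfl⟩ := Nat.exists_eq_succ_of_ne_zero hn.ne'
  refine word_injective h ?_
  obtain ⟨⟨a, p⟩, hp⟩ := p
  obtain ⟨⟨b, q⟩, hq⟩ := q
  exact congrArg P.s (List.cons.inj h).1

theorem word_rebracket {P : EdgeSet V V} : ∀ {n : ℕ} (x : (fib P (pow P n)).carrier),
    word ((rebracket P n).toEquiv x).1.1 ++ [((rebracket P n).toEquiv x).1.2] = x.1.1 :: word x.1.2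
  | 0, _ => rfl
  | _ + 1, ⟨(a, p), _⟩ => congrArg (a :: ·) (word_rebracket (P := P) p)

theorem exists_path_to {P : EdgeSet V V} (hP : ∀ v, ∃ e, P.r e = v) (v : V) :
    ∀ n, ∃ p : (pow P n).carrier, (pow P n).r p = v
  | 0 => ⟨v, rfl⟩
  | n + 1 => by
    obtain ⟨p, hp⟩ := exists_path_to hP v n
    obtain ⟨e, he⟩ := hP ((pow P n).s p)
    exact ⟨⟨(e, p), he⟩, hp⟩

theorem exists_path_from {P : EdgeSet V V} (hP : ∀ v, ∃ e, P.s e = v) :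
    ∀ (n : ℕ) (v : V), ∃ p : (pow P n).carrier, (pow P n).s p = v
  | 0, v => ⟨v, rfl⟩
  | n + 1, v => by
    obtain ⟨e, he⟩ := hP v
    obtain ⟨p, hp⟩ := exists_path_from hP n (P.r e)
    exact ⟨⟨(e, p), hp.symm⟩, he⟩

end Words

/-! ### The isomorphisms φ and φ⁽ⁿ⁾ as relations -/

section Runs

variable {V W : Type u} {A : EdgeSet V V} {B : EdgeSet W W} {R : EdgeSet V W}

/-- The relation `φ (a, x) = (y, b)`. -/
def Step (φ : PathIso (fib A R) (fib R B)) (a : A.carrier) (x y : R.carrier) (b : B.carrier) :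
    Prop :=
  ∃ h k, φ.toEquiv ⟨(a, x), h⟩ = ⟨(y, b), k⟩

/-- The relation `φ⁽ⁿ⁾ (w, x) = (y, w')` on lists of edges. -/
inductive Run (φ : PathIso (fib A R) (fib R B)) :
    List A.carrier → R.carrier → R.carrier → List B.carrier → Prop
  | nil (x : R.carrier) : Run φ [] x x []
  | cons {a : A.carrier} {b : B.carrier} {l : List A.carrier} {l' : List B.carrier}
      {x y z : R.carrier} : Run φ l x y l' → Step φ a y z b → Run φ (a :: l) x z (b :: l')

variable {φ : PathIso (fib A R) (fib R B)}

theorem step_apply (φ : PathIso (fib A R) (fib R B)) (p : (fib A R).carrier) :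
    Step φ p.1.1 p.1.2 (φ.toEquiv p).1.1 (φ.toEquiv p).1.2 :=
  ⟨p.2, (φ.toEquiv p).2, rfl⟩

theorem Step.r_eq {a x y b} (h : Step φ a x y b) : A.r a = R.s x := h.1
theorem Step.r_eq' {a x y b} (h : Step φ a x y b) : R.r y = B.s b := h.2.1

theorem Step.s_eq {a x y b} (h : Step φ a x y b) : R.s y = A.s a := by
  obtain ⟨h, h', e⟩ := h
  have := φ.map_s ⟨(a, x), h⟩
  rw [e] at this
  exact this

theorem Step.s_eq' {a x y b} (h : Step φ a x y b) : B.r b = R.r x := by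
  obtain ⟨h, h', e⟩ := h
  have := φ.map_r ⟨(a, x), h⟩
  rw [e] at this
  exact this

theorem Step.right_unique {a x y b y' b'} (h : Step φ a x y b) (h' : Step φ a x y' b') :
    y = y' ∧ b = b' := by
  obtain ⟨_, _, e⟩ := h
  obtain ⟨_, _, e'⟩ := h'
  exact Prod.mk.inj (Subtype.ext_iff.1 (e.symm.trans e'))

theorem Step.left_unique {a x y b a' x'} (h : Step φ a x y b) (h' : Step φ a' x' y b) :
    a = a' ∧ x = x' := by
  obtain ⟨_, _, e⟩ := h
  obtain ⟨_, _, e'⟩ := h'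
  exact Prod.mk.inj (Subtype.ext_iff.1 (φ.toEquiv.injective (e.trans e'.symm)))

theorem exists_step (φ : PathIso (fib A R) (fib R B)) {a x} (h : A.r a = R.s x) :
    ∃ y b, Step φ a x y b :=
  ⟨_, _, step_apply φ ⟨(a, x), h⟩⟩

/-- A run reads its list from the right: `Run.cons` appends a final step, while this puts a new step
before all the others. -/
theorem Run.snoc {l x y l' a z b} (h : Run φ l x y l') (hs : Step φ a z x b) :
    Run φ (l ++ [a]) z y (l' ++ [b]) := by
  induction h with
  | nil x => exact .cons (.nil _) hs
  | cons h h' ih => exact .cons (ih hs) h'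

theorem run_iter (φ : PathIso (fib A R) (fib R B)) :
    ∀ {n : ℕ} (p : (fib (pow A n) R).carrier),
      Run φ (word p.1.1) p.1.2 ((φ.iter n).toEquiv p).1.1 (word ((φ.iter n).toEquiv p).1.2)
  | 0, ⟨(_, x), _⟩ => .nil x
  | n + 1, ⟨(⟨(a, w), h⟩, x), h'⟩ => by
    have ih := run_iter φ (n := n) ⟨(w, x), h'⟩
    refine Run.cons ih (step_apply φ ⟨(a, _), ?_⟩)
    exact h.trans ((φ.iter n).map_s ⟨(w, x), h'⟩).symm

/-- Converse of `run_iter`. The exponent is `l.length` itself so that it grows with the list in the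
induction. -/
theorem Run.exists_step_iter_length {l x y l'} (h : Run φ l x y l') :
    ∃ (w : (pow A l.length).carrier) (w' : (pow B l.length).carrier),
      word w = l ∧ word w' = l' ∧ Step (φ.iter l.length) w x y w' := by
  induction h with
  | nil x => exact ⟨R.s x, R.r x, rfl, rfl, rfl, rfl, rfl⟩
  | @cons a b l l' x y z h hs ih =>
    obtain ⟨w, w', e1, e2, h1, h2, e⟩ := ih
    have h3 : A.r a = (pow A l.length).s w := by
      have := (φ.iter l.length).map_s ⟨(w, x), h1⟩
      rw [e] at this
      exact hs.r_eq.trans this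
    have h4 : B.r b = (pow B l.length).s w' := hs.s_eq'.trans h2
    obtain ⟨h5, h6, e3⟩ := hs
    refine ⟨⟨(a, w), h3⟩, ⟨(b, w'), h4⟩, congrArg (a :: ·) e1, congrArg (b :: ·) e2, h1, h6, ?_⟩
    let f : (fib A (fib R (pow B l.length))).carrier → _ := fun q =>
      (assoc R B (pow B l.length)).toEquiv ((φ.prod (refl (pow B l.length))).toEquiv
        ((assoc A R (pow B l.length)).symm.toEquiv q))
    have key : f (((refl A).prod (φ.iter l.length)).toEquiv ⟨(a, ⟨(w, x), h1⟩), h3⟩) =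
        ⟨(z, ⟨(b, w'), h4⟩), h6⟩ := by
      have : ((refl A).prod (φ.iter l.length)).toEquiv ⟨(a, ⟨(w, x), h1⟩), h3⟩ =
          ⟨(a, ⟨(y, w'), h2⟩), h5⟩ := Subtype.ext (Prod.ext rfl e)
      rw [this]
      have : (φ.prod (refl (pow B l.length))).toEquiv ⟨(⟨(a, y), h5⟩, w'), h2⟩ =
          ⟨(⟨(z, b), h6⟩, w'), h4⟩ := Subtype.ext (Prod.ext e3 rfl)
      exact congrArg (assoc R B (pow B l.length)).toEquiv this
    exact key

theorem Run.exists_step_iter {n l x y l'} (h : Run φ l x y l') (hn : l.length = n) :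
    ∃ (w : (pow A n).carrier) (w' : (pow B n).carrier),
      word w = l ∧ word w' = l' ∧ Step (φ.iter n) w x y w' := by
  subst hn
  exact h.exists_step_iter_length

theorem Step.run {n : ℕ} {w x y w'} (h : Step (φ.iter n) w x y w') :
    Run φ (word w) x y (word w') := by
  obtain ⟨h1, h2, e⟩ := h
  have := run_iter φ (n := n) ⟨(w, x), h1⟩
  rwa [e] at this

theorem Run.length_eq {l x y l'} (h : Run φ l x y l') : l'.length = l.length := by
  induction h with
  | nil => rfl
  | cons _ _ ih => simp [ih]

end Runs

/-! ### Alignment and balance of one half of a shift -/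

section Halves

variable {V W : Type u} {A : EdgeSet V V} {B : EdgeSet W W} {R : EdgeSet V W} {S : EdgeSet W V}
  {m : ℕ}

/-- `(ψ × id)(id × φ')(φ × id) = id × ψ`. -/
def HalfAligned (φ : PathIso (fib A R) (fib R B)) (φ' : PathIso (fib B S) (fib S A))
    (ψ : PathIso (fib R S) (pow A m)) : Prop :=
  (φ.prod (refl S)).trans
      ((assoc R B S).trans
        (((refl R).prod φ').trans ((assoc R S A).symm.trans (ψ.prod (refl A)))))
    = (assoc A R S).trans (((refl A).prod ψ).trans (rebracket A m))

/-- `ψ⁻¹ × ψ = (id × φ'⁽ᵐ⁾)(φ⁽ᵐ⁾ × id)`. -/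
def HalfBalanced (φ : PathIso (fib A R) (fib R B)) (φ' : PathIso (fib B S) (fib S A))
    (ψ : PathIso (fib R S) (pow A m)) : Prop :=
  (assoc (pow A m) R S).trans ((ψ.symm.prod ψ).trans (assoc R S (pow A m)))
    = ((φ.iter m).prod (refl S)).trans
        ((assoc R (pow B m) S).trans ((refl R).prod (φ'.iter m)))

/-- The relation `ψ (x, y) = t`. -/
def Joins {U V W : Type u} {R : EdgeSet U V} {S : EdgeSet V W} {T : EdgeSet U W}
    (ψ : PathIso (fib R S) T) (x : R.carrier) (y : S.carrier) (t : T.carrier) : Prop :=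
  ∃ h, ψ.toEquiv ⟨(x, y), h⟩ = t

section Joins

variable {U V W : Type u} {R : EdgeSet U V} {S : EdgeSet V W} {T : EdgeSet U W}
  {ψ : PathIso (fib R S) T}

theorem joins_apply (ψ : PathIso (fib R S) T) (p : (fib R S).carrier) :
    Joins ψ p.1.1 p.1.2 (ψ.toEquiv p) :=
  ⟨p.2, rfl⟩

theorem exists_joins (ψ : PathIso (fib R S) T) {x y} (h : R.r x = S.s y) : ∃ t, Joins ψ x y t :=
  ⟨_, h, rfl⟩

theorem exists_joins_symm (ψ : PathIso (fib R S) T) (t : T.carrier) : ∃ x y, Joins ψ x y t :=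
  ⟨_, _, (ψ.symm.toEquiv t).2, Equiv.apply_symm_apply _ _⟩

theorem Joins.r_eq {x y t} (h : Joins ψ x y t) : R.r x = S.s y := h.1

theorem Joins.s_eq {x y t} (h : Joins ψ x y t) : T.s t = R.s x := by
  obtain ⟨h, rfl⟩ := h
  exact ψ.map_s _

theorem Joins.r_eq' {x y t} (h : Joins ψ x y t) : T.r t = S.r y := by
  obtain ⟨h, rfl⟩ := h
  exact ψ.map_r _

theorem Joins.right_unique {x y t t'} (h : Joins ψ x y t) (h' : Joins ψ x y t') : t = t' := by
  obtain ⟨_, rfl⟩ := h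
  obtain ⟨_, rfl⟩ := h'
  rfl

theorem Joins.left_unique {x y x' y' t} (h : Joins ψ x y t) (h' : Joins ψ x' y' t) :
    x = x' ∧ y = y' := by
  obtain ⟨_, rfl⟩ := h
  obtain ⟨_, e⟩ := h'
  exact Prod.mk.inj (Subtype.ext_iff.1 (ψ.toEquiv.injective e.symm))

theorem Joins.symm_apply {x y t} (h : Joins ψ x y t) :
    ψ.symm.toEquiv t = ⟨(x, y), h.1⟩ := by
  obtain ⟨_, rfl⟩ := h
  exact Equiv.symm_apply_apply _ _

end Joins

variable {φ : PathIso (fib A R) (fib R B)} {φ' : PathIso (fib B S) (fib S A)}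
  {ψ : PathIso (fib R S) (pow A m)}

theorem PathIso.ext_apply {P Q : EdgeSet V W} {f g : PathIso P Q}
    (h : ∀ x, f.toEquiv x = g.toEquiv x) : f = g :=
  PathIso.ext (Equiv.ext h)

theorem PathIso.congr_apply {P Q : EdgeSet V W} {f g : PathIso P Q} (h : f = g) (x : P.carrier) :
    f.toEquiv x = g.toEquiv x := by rw [h]

/-- Comparing words absorbs the two bracketings of a path of length m + 1, so alignment becomes an
equation of lists: the window slides by one edge. -/
theorem halfAligned_iff : HalfAligned φ φ' ψ ↔
    ∀ a x y x' b y' a' l l', Step φ a x x' b → Step φ' b y y' a' → Joins ψ x y l →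
      Joins ψ x' y' l' → a :: word l = word l' ++ [a'] := by
  constructor
  · rintro H a x y x' b y' a' _ _ h1 h2 ⟨h3, rfl⟩ ⟨h4, rfl⟩
    obtain ⟨h5, h6, e⟩ := h1
    obtain ⟨h7, h8, e'⟩ := h2
    have := PathIso.congr_apply H ⟨(⟨(a, x), h5⟩, y), h3⟩
    have e1 : (φ.prod (refl S)).toEquiv ⟨(⟨(a, x), h5⟩, y), h3⟩ = ⟨(⟨(x', b), h6⟩, y), h7⟩ :=
      Subtype.ext (Prod.ext e rfl)
    have e2 : ((refl R).prod φ').toEquiv ⟨(x', ⟨(b, y), h7⟩), h6⟩ = ⟨(x', ⟨(y', a'), h8⟩), h4⟩ :=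
      Subtype.ext (Prod.ext rfl e')
    have e3 := this.symm.trans <| (congrArg ((assoc R B S).trans
        (((refl R).prod φ').trans ((assoc R S A).symm.trans (ψ.prod (refl A))))).toEquiv e1).trans
      (congrArg ((assoc R S A).symm.trans (ψ.prod (refl A))).toEquiv e2)
    have e4 := word_rebracket (P := A) (n := m) ⟨(a, ψ.toEquiv ⟨(x, y), h3⟩),
      h5.trans (ψ.map_s ⟨(x, y), h3⟩).symm⟩
    rw [← e4]
    exact congrArg (fun q : (fib (pow A m) A).carrier => word q.1.1 ++ [q.1.2]) e3
  · intro H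
    refine PathIso.ext_apply fun p => ?_
    obtain ⟨⟨⟨⟨a, x⟩, h⟩, y⟩, h'⟩ := p
    set L := (φ.prod (refl S)).trans ((assoc R B S).trans
        (((refl R).prod φ').trans ((assoc R S A).symm.trans (ψ.prod (refl A)))))
    set L' := (assoc A R S).trans (((refl A).prod ψ).trans (rebracket A m))
    set p : (fib (fib A R) S).carrier := ⟨(⟨(a, x), h⟩, y), h'⟩
    have hs : (fib (pow A m) A).s (L.toEquiv p) = (fib (pow A m) A).s (L'.toEquiv p) :=
      (L.map_s p).trans (L'.map_s p).symm
    have hw : word (L.toEquiv p).1.1 ++ [(L.toEquiv p).1.2] =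
        word (L'.toEquiv p).1.1 ++ [(L'.toEquiv p).1.2] := by
      have hb := (((φ.prod (refl S)).toEquiv p)).2
      have hc := ((assoc R S A).symm.toEquiv (((refl R).prod φ').toEquiv
        ((assoc R B S).toEquiv ((φ.prod (refl S)).toEquiv p)))).1.1.2
      refine Eq.trans ?_ (word_rebracket (P := A) (n := m) ⟨(a, ψ.toEquiv ⟨(x, y), h'⟩),
        h.trans (ψ.map_s ⟨(x, y), h'⟩).symm⟩).symm
      exact (H _ _ _ _ _ _ _ _ _ (step_apply φ ⟨(a, x), h⟩) (step_apply φ' ⟨(_, y), hb⟩)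
        ⟨h', rfl⟩ ⟨hc, rfl⟩).symm
    obtain ⟨e1, e2⟩ := List.append_inj' hw rfl
    exact Subtype.ext (Prod.ext (word_injective e1 hs) (List.singleton_inj.1 e2))

theorem halfBalanced_iff : HalfBalanced φ φ' ψ ↔
    ∀ w x y x' w' y' w'', Step (φ.iter m) w x x' w' → Step (φ'.iter m) w' y y' w'' →
      R.r x = S.s y → Joins ψ x y w'' ∧ Joins ψ x' y' w := by
  constructor
  · rintro H w x y x' w' y' w'' ⟨h1, h2, e1⟩ ⟨h3, h4, e2⟩ h
    have := PathIso.congr_apply H ⟨(⟨(w, x), h1⟩, y), h⟩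
    have e3 : ((φ.iter m).prod (refl S)).toEquiv ⟨(⟨(w, x), h1⟩, y), h⟩ =
        ⟨(⟨(x', w'), h2⟩, y), h3⟩ := Subtype.ext (Prod.ext e1 rfl)
    have hs : (pow B m).s w' = S.s y' := (Step.s_eq ⟨h3, h4, e2⟩).symm
    have e4 : ((refl R).prod (φ'.iter m)).toEquiv ⟨(x', ⟨(w', y), h3⟩), h2⟩ =
        ⟨(x', ⟨(y', w''), h4⟩), h2.trans hs⟩ := Subtype.ext (Prod.ext rfl e2)
    have e5 := this.trans <| (congrArg ((assoc R (pow B m) S).trans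
      ((refl R).prod (φ'.iter m))).toEquiv e3).trans e4
    have e6 : (ψ.symm.toEquiv w).1.1 = x' := congrArg (fun q => q.1.1) e5
    have e7 : (ψ.symm.toEquiv w).1.2 = y' := congrArg (fun q => q.1.2.1.1) e5
    have e8 : ψ.toEquiv ⟨(x, y), h⟩ = w'' := congrArg (fun q => q.1.2.1.2) e5
    subst e6 e7
    exact ⟨⟨h, e8⟩, ⟨(ψ.symm.toEquiv w).2, Equiv.apply_symm_apply _ _⟩⟩
  · intro H
    refine PathIso.ext_apply fun p => ?_
    obtain ⟨⟨⟨⟨w, x⟩, h⟩, y⟩, h'⟩ := p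
    have hb := ((((φ.iter m).prod (refl S)).toEquiv ⟨(⟨(w, x), h⟩, y), h'⟩)).2
    obtain ⟨j1, j2⟩ := H _ _ _ _ _ _ _ (step_apply (φ.iter m) ⟨(w, x), h⟩)
      (step_apply (φ'.iter m) ⟨(_, y), hb⟩) h'
    have e := j2.symm_apply
    refine Subtype.ext (Prod.ext ?_ (Subtype.ext (Prod.ext ?_ ?_)))
    · exact congrArg (fun q => q.1.1) e
    · exact congrArg (fun q => q.1.2) e
    · exact j1.2

/-- The path isomorphism `(id × γ)(α⁻¹ × id)`, i.e. `(α (x, y), z) ↦ (x, γ (y, z))`. -/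
def exchange {V W : Type u} {A : EdgeSet V V} {B : EdgeSet W W} {R : EdgeSet V W}
    {S : EdgeSet W V} (α : PathIso (fib R S) A) (γ : PathIso (fib S R) B) :
    PathIso (fib A R) (fib R B) :=
  (α.symm.prod (refl R)).trans ((assoc R S R).trans ((refl R).prod γ))

theorem Joins.step_exchange {V W : Type u} {A : EdgeSet V V} {B : EdgeSet W W} {R : EdgeSet V W}
    {S : EdgeSet W V} {α : PathIso (fib R S) A} {γ : PathIso (fib S R) B} {x y z a b}
    (j : Joins α x y a) (j' : Joins γ y z b) : Step (exchange α γ) a z x b := by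
  have h : A.r a = R.s z := j.r_eq'.trans j'.r_eq
  refine ⟨h, j.r_eq.trans j'.s_eq.symm, ?_⟩
  have e : (α.symm.prod (refl R)).toEquiv ⟨(a, z), h⟩ = ⟨(⟨(x, y), j.1⟩, z), j'.1⟩ :=
    Subtype.ext (Prod.ext j.symm_apply rfl)
  refine (congrArg ((assoc R S R).trans ((refl R).prod γ)).toEquiv e).trans ?_
  exact Subtype.ext (Prod.ext rfl j'.2)

theorem Step.exists_joins {V W : Type u} {A : EdgeSet V V} {B : EdgeSet W W} {R : EdgeSet V W}
    {S : EdgeSet W V} {α : PathIso (fib R S) A} {γ : PathIso (fib S R) B} {x z a b}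
    (h : Step (exchange α γ) a z x b) : ∃ y, Joins α x y a ∧ Joins γ y z b := by
  obtain ⟨x', y, j⟩ := exists_joins_symm α a
  obtain ⟨b', k⟩ := ShiftEq.exists_joins γ (j.r_eq'.symm.trans h.r_eq)
  obtain ⟨rfl, rfl⟩ := h.right_unique (j.step_exchange k)
  exact ⟨y, j, k⟩

/-- `φ⁽ᵐ⁾ = (id × ψ')(ψ⁻¹ × id)`. -/
def HalfCompatible (φ : PathIso (fib A R) (fib R B)) (ψ : PathIso (fib R S) (pow A m))
    (ψ' : PathIso (fib S R) (pow B m)) : Prop :=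
  φ.iter m = exchange ψ ψ'

theorem halfCompatible_iff {ψ' : PathIso (fib S R) (pow B m)} : HalfCompatible φ ψ ψ' ↔
    ∀ x y z w w', Joins ψ x y w → Joins ψ' y z w' → Step (φ.iter m) w z x w' := by
  refine ⟨fun H x y z w w' j j' => ?_, fun H => PathIso.ext_apply fun p => ?_⟩
  · rw [H]
    exact j.step_exchange j'
  · obtain ⟨y, j, j'⟩ := (step_apply (exchange ψ ψ') p).exists_joins
    obtain ⟨_, _, e⟩ := H _ _ _ _ _ j j'
    exact e

theorem HalfBalanced.of_run (H : HalfBalanced φ φ' ψ) (hm : 0 < m) {l l' l'' x y x' y'}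
    (hl : l.length = m) (h : Run φ l x x' l') (h' : Run φ' l' y y' l'') (hxy : R.r x = S.s y) :
    (∃ w, Joins ψ x y w ∧ word w = l'') ∧ ∃ w, Joins ψ x' y' w ∧ word w = l := by
  obtain ⟨w, w', rfl, rfl, hs⟩ := h.exists_step_iter hl
  obtain ⟨w₂, w'', e, rfl, hs'⟩ := h'.exists_step_iter (word_length w')
  obtain rfl := word_injective_of_pos hm e
  obtain ⟨j1, j2⟩ := halfBalanced_iff.1 H _ _ _ _ _ _ _ hs hs' hxy
  exact ⟨⟨_, j1, rfl⟩, _, j2, rfl⟩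

/-- Consecutive steps of aligned isomorphisms shift a window along a path. -/
theorem HalfAligned.append_eq (H : HalfAligned φ φ' ψ) {l l' l'' x y x' y' u u'}
    (h : Run φ l x x' l') (h' : Run φ' l' y y' l'') (j : Joins ψ x y u) (j' : Joins ψ x' y' u') :
    l ++ word u = word u' ++ l'' := by
  induction h generalizing l'' y' u' with
  | nil =>
    cases h'
    rw [j.right_unique j', List.nil_append, List.append_nil]
  | @cons a b l l' x x₁ x' h hs ih =>
    cases h' with
    | @cons _ c _ l'' _ y₁ y' h' hs' =>
      -- `u₁` is the window just before the final step: the induction hypothesis slides up to it,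
      -- and alignment slides once more.
      obtain ⟨u₁, j₁⟩ := exists_joins ψ (hs.s_eq'.symm.trans hs'.r_eq)
      have e := halfAligned_iff.1 H _ _ _ _ _ _ _ _ _ hs hs' j₁ j'
      rw [List.cons_append, ih h' j j₁, ← List.cons_append, e, List.append_assoc,
        List.singleton_append]

theorem HalfAligned.halfBalanced (H : HalfAligned φ φ' ψ) (hm : 0 < m) :
    HalfBalanced φ φ' ψ := by
  refine halfBalanced_iff.2 fun w x y x' w' y' w'' h h' hxy => ?_
  obtain ⟨u, j⟩ := exists_joins ψ hxy
  obtain ⟨u', j'⟩ := exists_joins ψ (x := x') (y := y') (h.r_eq'.trans h'.s_eq.symm)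
  -- All four words have length m, so the equation splits in the middle.
  obtain ⟨e, e'⟩ := List.append_inj (H.append_eq h.run h'.run j j') (by simp [word_length])
  obtain rfl := word_injective_of_pos hm e'
  obtain rfl := word_injective e (h.s_eq.symm.trans j'.s_eq.symm)
  exact ⟨j, j'⟩

theorem exists_runs (φ : PathIso (fib A R) (fib R B)) (φ' : PathIso (fib B S) (fib S A)) {n x y}
    (p : (pow A n).carrier) (hx : (pow A n).r p = R.s x) (hxy : R.r x = S.s y) :
    ∃ x' l' y' l'', Run φ (word p) x x' l' ∧ Run φ' l' y y' l'' ∧ R.s x' = (pow A n).s p ∧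
      R.r x' = S.s y' := by
  obtain ⟨x', w', h⟩ := exists_step (φ.iter n) hx
  obtain ⟨y', w'', h'⟩ := exists_step (φ'.iter n) (h.s_eq'.trans hxy)
  exact ⟨x', _, y', _, h.run, h'.run, h.s_eq, h.r_eq'.trans h'.s_eq.symm⟩

/-- A step outputs the last edge of the current window. -/
theorem HalfBalanced.exists_append (H : HalfBalanced φ φ' ψ) (hm : 0 < m)
    (hA : ∀ v, ∃ e, A.r e = v) {a x y x' b y' a' u} (h : Step φ a x x' b) (h' : Step φ' b y y' a')
    (j : Joins ψ x y u) : ∃ l, word u = l ++ [a'] := by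
  obtain ⟨k, rfl⟩ := Nat.exists_eq_succ_of_ne_zero hm.ne'
  -- Balance speaks only of words of length m = k + 1, so `a` is completed backwards by a path of
  -- length k.
  obtain ⟨p, hp⟩ := exists_path_to hA (A.s a) k
  obtain ⟨x₂, l', y₂, l'', h₁, h₂, -, -⟩ := exists_runs φ φ' p (hp.trans h.s_eq.symm)
    (h.r_eq'.trans h'.s_eq.symm)
  obtain ⟨⟨w, j₁, e₁⟩, -⟩ := H.of_run hm (by simp [word_length]) (h₁.snoc h) (h₂.snoc h') j.r_eq
  exact ⟨l'', by rw [j.right_unique j₁, e₁]⟩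

/-- Complete `a` to `p a` of length m, and let `l'' a'` be the resulting output; by balance ψ(x, y)
= l'' a'. One more step, by an edge `a₀` in front of `p`, puts out some `c`; reading `a₀ p` from
(x₁, y₁) gives ψ(x₁, y₁) = c l''. Alignment therefore amounts to `a = c`. -/
theorem HalfBalanced.halfAligned (H : HalfBalanced φ φ' ψ) (hm : 0 < m)
    (hA : ∀ v, ∃ e, A.r e = v) : HalfAligned φ φ' ψ := by
  refine halfAligned_iff.2 fun a x y x₁ b y₁ a' u u₁ h h' j j₁ => ?_
  obtain ⟨k, rfl⟩ := Nat.exists_eq_succ_of_ne_zero hm.ne'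
  obtain ⟨p, hp⟩ := exists_path_to hA (A.s a) k
  obtain ⟨x₂, l', y₂, l'', h₁, h₂, hs, hr⟩ := exists_runs φ φ' p (hp.trans h.s_eq.symm) j₁.r_eq
  obtain ⟨⟨w, jw, ew⟩, u₂, j₂, e₂⟩ :=
    H.of_run hm (by simp [word_length]) (h₁.snoc h) (h₂.snoc h') j.r_eq
  obtain ⟨a₀, ha₀⟩ := hA (R.s x₂)
  obtain ⟨x₃, b₃, h₃⟩ := exists_step φ ha₀
  obtain ⟨y₃, c, h₃'⟩ := exists_step φ' (h₃.s_eq'.trans hr)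
  obtain ⟨l, hl⟩ := H.exists_append hm hA h₃ h₃' j₂
  -- The window of (x₂, y₂) ends in `a`, being the word read in, and ends in `c`, being about to put
  -- out `c`.
  have hc : a = c := List.singleton_inj.1 (List.append_inj' (e₂.symm.trans hl) rfl).2
  obtain ⟨⟨w₁, jw₁, ew₁⟩, -⟩ :=
    H.of_run hm (by simp [word_length]) (h₁.cons h₃) (h₂.cons h₃') j₁.r_eq
  rw [j.right_unique jw, j₁.right_unique jw₁, ew, ew₁, hc, List.cons_append]

end Halves

/-! ### Balance and compatibility -/

section Compatible

variable {V W : Type u} {A : EdgeSet V V} {B : EdgeSet W W} {R : EdgeSet V W} {S : EdgeSet W V}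
  {m : ℕ} {φ : PathIso (fib A R) (fib R B)} {φ' : PathIso (fib B S) (fib S A)}
  {ψ : PathIso (fib R S) (pow A m)}

theorem HalfCompatible.halfBalanced {ψ' : PathIso (fib S R) (pow B m)}
    (H : HalfCompatible φ ψ ψ') (H' : HalfCompatible φ' ψ' ψ) : HalfBalanced φ φ' ψ := by
  refine halfBalanced_iff.2 fun w x y x' w' y' w'' h h' hxy => ?_
  obtain ⟨x₁, y₁, j₁⟩ := exists_joins_symm ψ w
  obtain ⟨w₁, j₂⟩ := exists_joins ψ' (x := y₁) (y := x) (j₁.r_eq'.symm.trans h.r_eq)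
  obtain ⟨w₂, j₃⟩ := exists_joins ψ hxy
  obtain ⟨rfl, rfl⟩ := h.right_unique (halfCompatible_iff.1 H _ _ _ _ _ j₁ j₂)
  obtain ⟨rfl, rfl⟩ := h'.right_unique (halfCompatible_iff.1 H' _ _ _ _ _ j₂ j₃)
  exact ⟨j₃, j₁⟩

/-- A balanced pair determines the second window isomorphism of a compatible shift. -/
theorem HalfBalanced.exists_halfCompatible (H : HalfBalanced φ φ' ψ) (hR : ∀ w, ∃ x, R.r x = w)
    (hS : ∀ w, ∃ y, S.s y = w) :
    ∃ ψ' : PathIso (fib S R) (pow B m), HalfCompatible φ ψ ψ' ∧ HalfCompatible φ' ψ' ψ := by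
  have H := halfBalanced_iff.1 H
  have key : ∀ y z, S.r y = R.s z → ∃ w', ∀ x w, Joins ψ x y w → Step (φ.iter m) w z x w' := by
    intro y z hyz
    obtain ⟨y₁, hy₁⟩ := hS (R.r z)
    have step : ∀ x w, Joins ψ x y w → ∃ w' w'', Step (φ.iter m) w z x w' ∧
        Step (φ'.iter m) w' y₁ y w'' ∧ Joins ψ z y₁ w'' := by
      intro x w j
      obtain ⟨x', w', h⟩ := exists_step (φ.iter m) (j.r_eq'.trans hyz)
      obtain ⟨y', w'', h'⟩ := exists_step (φ'.iter m) (h.s_eq'.trans hy₁.symm)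
      -- Balance identifies (x', y') with (x, y). Hence φ'⁽ᵐ⁾ sends (w', y₁) to (y, ψ(z, y₁)), in
      -- which x does not occur; injectivity of φ'⁽ᵐ⁾ then makes w' independent of x.
      obtain ⟨j₁, j₂⟩ := H _ _ _ _ _ _ _ h h' hy₁.symm
      obtain ⟨rfl, rfl⟩ := j.left_unique j₂
      exact ⟨_, _, h, h', j₁⟩
    obtain ⟨x₀, hx₀⟩ := hR (S.s y)
    obtain ⟨w₀, j₀⟩ := exists_joins ψ hx₀
    obtain ⟨w₀', w₀'', h₀, h₀', i₀⟩ := step x₀ w₀ j₀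
    refine ⟨w₀', fun x w j => ?_⟩
    obtain ⟨w', w'', h, h', i⟩ := step x w j
    obtain rfl := i.right_unique i₀
    rwa [(h₀'.left_unique h').1]
  choose f hf using key
  let F : (fib S R).carrier → (pow B m).carrier := fun p => f p.1.1 p.1.2 p.2
  have hF : ∀ p x w, Joins ψ x p.1.1 w → Step (φ.iter m) w p.1.2 x (F p) := fun p => hf _ _ p.2
  have hbij : F.Bijective := by
    constructor
    · rintro p q hpq
      obtain ⟨x₀, hx₀⟩ := hR (S.s p.1.1)
      obtain ⟨w₀, j₀⟩ := exists_joins ψ hx₀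
      obtain ⟨x₁, hx₁⟩ := hR (S.s q.1.1)
      obtain ⟨w₁, j₁⟩ := exists_joins ψ hx₁
      have h₀ := (hF p _ _ j₀).r_eq'
      have h₁ := (hF q _ _ j₁).r_eq'
      -- Equal values have equal sources, so the same `x₀` can be put before both pairs, and
      -- injectivity of φ⁽ᵐ⁾ applies.
      have hq : R.r x₀ = S.s q.1.1 := by rw [h₀, hpq, ← h₁, hx₁]
      obtain ⟨w₂, j₂⟩ := exists_joins ψ hq
      have h₂ := hF q _ _ j₂
      rw [← hpq] at h₂
      obtain ⟨rfl, e⟩ := (hF p _ _ j₀).left_unique h₂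
      exact Subtype.ext (Prod.ext (j₀.left_unique j₂).2 e)
    · intro w'
      obtain ⟨x, hx⟩ := hR ((pow B m).s w')
      obtain ⟨w, z, h⟩ : ∃ w z, Step (φ.iter m) w z x w' :=
        ⟨_, _, ((φ.iter m).symm.toEquiv ⟨(x, w'), hx⟩).2, hx, Equiv.apply_symm_apply _ _⟩
      obtain ⟨x₁, y₁, j⟩ := exists_joins_symm ψ w
      have h₂ := hF ⟨(y₁, z), j.r_eq'.symm.trans h.r_eq⟩ _ _ j
      exact ⟨_, (h₂.right_unique h).2⟩
  have hs : ∀ p, (pow B m).s (F p) = S.s p.1.1 := by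
    intro p
    obtain ⟨x, hx⟩ := hR (S.s p.1.1)
    obtain ⟨w, j⟩ := exists_joins ψ hx
    rw [← (hF p _ _ j).r_eq', hx]
  have hr : ∀ p, (pow B m).r (F p) = R.r p.1.2 := by
    intro p
    obtain ⟨x, hx⟩ := hR (S.s p.1.1)
    obtain ⟨w, j⟩ := exists_joins ψ hx
    exact (hF p _ _ j).s_eq'
  refine ⟨⟨Equiv.ofBijective F hbij, hs, hr⟩, halfCompatible_iff.2 ?_, halfCompatible_iff.2 ?_⟩
  · rintro x y z w _ j ⟨h, rfl⟩
    exact hF ⟨(y, z), h⟩ _ _ j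
  · rintro y z y' _ w'' ⟨h, rfl⟩ j'
    obtain ⟨x, hx⟩ := hR (S.s y)
    obtain ⟨w, j⟩ := exists_joins ψ hx
    have h₁ : Step (φ.iter m) w z x (F ⟨(y, z), h⟩) := hF ⟨(y, z), h⟩ _ _ j
    obtain ⟨y₂, w₂, h₂⟩ := exists_step (φ'.iter m) (h₁.s_eq'.trans j'.r_eq)
    obtain ⟨j₃, j₄⟩ := H _ _ _ _ _ _ _ h₁ h₂ j'.r_eq
    obtain rfl := j'.right_unique j₃
    obtain ⟨-, rfl⟩ := j.left_unique j₄
    exact h₂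

end Compatible

/-! ### Equivalence of the three notions at a fixed lag -/

section Matrices

variable {V W : Type u} {A : Matrix V V ℕ} {B : Matrix W W ℕ} {m : ℕ}

theorem Essential.exists_r_eq {F : Matrix V W ℕ} (hF : Essential F) (w : W) :
    ∃ e, (E F).r e = w := by
  obtain ⟨v, hv⟩ := hF.2 w
  exact ⟨⟨v, w, ⟨0, Nat.pos_of_ne_zero hv⟩⟩, rfl⟩

theorem Essential.exists_s_eq {F : Matrix V W ℕ} (hF : Essential F) (v : V) :
    ∃ e, (E F).s e = v := by
  obtain ⟨w, hw⟩ := hF.1 v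
  exact ⟨⟨v, w, ⟨0, Nat.pos_of_ne_zero hw⟩⟩, rfl⟩

theorem exists_left_s_eq {A : EdgeSet V V} {R : EdgeSet V W} {S : EdgeSet W V}
    (ψ : PathIso (fib R S) (pow A m)) (hA : ∀ v, ∃ e, A.s e = v) (v : V) : ∃ x, R.s x = v := by
  obtain ⟨p, hp⟩ := exists_path_from hA m v
  obtain ⟨x, y, j⟩ := exists_joins_symm ψ p
  exact ⟨x, j.s_eq.symm.trans hp⟩

theorem exists_right_r_eq {A : EdgeSet V V} {R : EdgeSet V W} {S : EdgeSet W V}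
    (ψ : PathIso (fib R S) (pow A m)) (hA : ∀ v, ∃ e, A.r e = v) (v : V) : ∃ y, S.r y = v := by
  obtain ⟨p, hp⟩ := exists_path_to hA v m
  obtain ⟨x, y, j⟩ := exists_joins_symm ψ p
  exact ⟨y, j.r_eq'.symm.trans hp⟩

theorem ConcreteShift.isAligned_iff_isBalanced (hA : Essential A) (hB : Essential B) (hm : 0 < m)
    (c : ConcreteShift A B m) : c.IsAligned ↔ c.IsBalanced :=
  and_congr
    (show HalfAligned c.φR c.φS c.ψA ↔ HalfBalanced c.φR c.φS c.ψA from
      ⟨fun H => H.halfBalanced hm, fun H => H.halfAligned hm hA.exists_r_eq⟩)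
    (show HalfAligned c.φS c.φR c.ψB ↔ HalfBalanced c.φS c.φR c.ψB from
      ⟨fun H => H.halfBalanced hm, fun H => H.halfAligned hm hB.exists_r_eq⟩)

theorem ConcreteShift.IsCompatible.isBalanced {c : ConcreteShift A B m} (H : c.IsCompatible) :
    c.IsBalanced :=
  ⟨HalfCompatible.halfBalanced H.1 H.2, HalfCompatible.halfBalanced H.2 H.1⟩

/-- Only ψ_B changes. The old one serves merely to show that every vertex of W is a range of R and a
source of S. -/
theorem ConcreteShift.compatibleLag_of_halfBalanced (hB : Essential B) (c : ConcreteShift A B m)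
    (H : HalfBalanced c.φR c.φS c.ψA) : CompatibleLag A B m := by
  obtain ⟨ψ', h, h'⟩ := H.exists_halfCompatible (exists_right_r_eq c.ψB hB.exists_r_eq)
    (exists_left_s_eq c.ψB hB.exists_s_eq)
  exact ⟨{ c with ψB := ψ' }, h, h'⟩

theorem alignedLag_iff_balancedLag (hA : Essential A) (hB : Essential B) (hm : 0 < m) :
    AlignedLag A B m ↔ BalancedLag A B m :=
  exists_congr (ConcreteShift.isAligned_iff_isBalanced hA hB hm)

theorem balancedLag_iff_compatibleLag (hB : Essential B) :
    BalancedLag A B m ↔ CompatibleLag A B m :=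
  ⟨fun ⟨c, H⟩ => c.compatibleLag_of_halfBalanced hB H.1, fun ⟨c, H⟩ => ⟨c, H.isBalanced⟩⟩

end Matrices

/-! ### Strong shift equivalence as an equivalence relation -/

section SSE

variable {V U W : Type u} [Fintype V] [Fintype U] [Fintype W]
  {A : Matrix V V ℕ} {C : Matrix U U ℕ} {B : Matrix W W ℕ}

theorem ElementarySSE.sse (h : ElementarySSE A B) : SSE A B := ⟨1, .single h⟩

theorem ElementarySSE.symm (h : ElementarySSE A B) : ElementarySSE B A := by
  obtain ⟨R, S, h, h'⟩ := h
  exact ⟨S, R, h'.symm, h.symm⟩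

theorem ElementarySSE.transpose (h : ElementarySSE A B) :
    ElementarySSE A.transpose B.transpose := by
  obtain ⟨R, S, rfl, rfl⟩ := h
  exact ⟨S.transpose, R.transpose, Matrix.transpose_mul _ _, (Matrix.transpose_mul _ _).symm⟩

end SSE

theorem SSELag.trans {m : ℕ} {V U W : Type u} [Fintype V] [Fintype U] [Fintype W]
    {A : Matrix V V ℕ} {C : Matrix U U ℕ} {B : Matrix W W ℕ} (h : SSELag m A C)
    (h' : SSE C B) : SSE A B := by
  induction h with
  | single h => exact h'.elim fun n t => ⟨n + 1, .cons h t⟩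
  | cons h _ ih => exact (ih h').elim fun n t => ⟨n + 1, .cons h t⟩

theorem SSE.trans {V U W : Type u} [Fintype V] [Fintype U] [Fintype W]
    {A : Matrix V V ℕ} {C : Matrix U U ℕ} {B : Matrix W W ℕ} (h : SSE A C)
    (h' : SSE C B) : SSE A B :=
  h.elim fun _ t => t.trans h'

theorem SSELag.symm {m : ℕ} {V W : Type u} [Fintype V] [Fintype W]
    {A : Matrix V V ℕ} {B : Matrix W W ℕ} (h : SSELag m A B) : SSE B A := by
  induction h with
  | single h => exact h.symm.sse
  | cons h _ ih => exact ih.trans h.symm.sse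

theorem SSE.symm {V W : Type u} [Fintype V] [Fintype W]
    {A : Matrix V V ℕ} {B : Matrix W W ℕ} (h : SSE A B) : SSE B A :=
  h.elim fun _ t => t.symm

theorem SSELag.transpose {m : ℕ} {V W : Type u} [Fintype V] [Fintype W]
    {A : Matrix V V ℕ} {B : Matrix W W ℕ} (h : SSELag m A B) :
    SSELag m A.transpose B.transpose := by
  induction h with
  | single h => exact .single h.transpose
  | cons h _ ih => exact .cons h.transpose ih

theorem SSELag.pos {m : ℕ} {V W : Type u} [Fintype V] [Fintype W]
    {A : Matrix V V ℕ} {B : Matrix W W ℕ} (h : SSELag m A B) : 0 < m := by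
  cases h <;> omega

/-! ### Collapsing covers by amalgamation -/

section Covers

variable {V : Type u}

/-- The matrix of a finite graph. -/
noncomputable def adj {V W : Type u} (P : EdgeSet V W) : Matrix V W ℕ :=
  fun v w => Nat.card {e : P.carrier // P.s e = v ∧ P.r e = w}

/-- The graph on `X` with an edge from `act e x` to `x` for each edge `e` into `π x`, where `X` is
a set over the vertices of `P` on which the edges of `P` act. -/
def cover (P : EdgeSet V V) {X : Type u} (π : X → V) (act : P.carrier → X → X) : EdgeSet X X where
  carrier := {p : P.carrier × X // P.r p.1 = π p.2}
  s := fun p => act p.1.1 p.1.2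
  r := fun p => p.1.2

/-- The points `x` and `y` lie over the same vertex and are not distinguished by the action of
words of length `k`. -/
def Indist (P : EdgeSet V V) {X : Type u} (π : X → V) (act : P.carrier → X → X) :
    ℕ → X → X → Prop
  | 0, x, y => x = y
  | k + 1, x, y => π x = π y ∧ ∀ e, P.r e = π x → Indist P π act k (act e x) (act e y)

theorem adj_cover_apply (P : EdgeSet V V) {X : Type u} (π : X → V) (act : P.carrier → X → X)
    (x y : X) : adj (cover P π act) x y = Nat.card {e : P.carrier // P.r e = π y ∧ act e y = x} :=
  Nat.card_congr
    { toFun := fun p => ⟨p.1.1.1, by obtain ⟨⟨⟨e, z⟩, h⟩, h', rfl⟩ := p; exact ⟨h, h'⟩⟩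
      invFun := fun e => ⟨⟨(e.1, y), e.2.1⟩, e.2.2, rfl⟩
      left_inv := by rintro ⟨⟨⟨e, z⟩, h⟩, h', rfl⟩; rfl
      right_inv := fun _ => rfl }

/-- The relation identifying points over the same vertex that are not distinguished by the action
of single edges. -/
def indistSetoid (P : EdgeSet V V) {X : Type u} (π : X → V) (act : P.carrier → X → X) :
    Setoid X where
  r := Indist P π act 1
  iseqv :=
    ⟨fun _ => ⟨rfl, fun _ _ => rfl⟩,
      fun h => ⟨h.1.symm, fun e he => (h.2 e (he.trans h.1.symm)).symm⟩,
      fun h h' => ⟨h.1.trans h'.1, fun e he => (h.2 e he).trans (h'.2 e (he.trans h.1))⟩⟩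

section Quotient

variable (P : EdgeSet V V) {X : Type u} (π : X → V) (act : P.carrier → X → X)

/-- The projection of the amalgamated cover. -/
def quotProj : Quotient (indistSetoid P π act) → V :=
  Quotient.lift π fun _ _ h => h.1

/-- The action on the amalgamated cover. -/
noncomputable def quotAct (e : P.carrier) (q : Quotient (indistSetoid P π act)) :
    Quotient (indistSetoid P π act) :=
  Quotient.mk _ (act e q.out)

theorem quotProj_out (q : Quotient (indistSetoid P π act)) : π q.out = quotProj P π act q := by
  conv_rhs => rw [← q.out_eq]
  rfl

/-- Edges not ending at `π x` act arbitrarily and need not respect the relation. This is why the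
action on the quotient is defined through representatives; on edges ending at `π x` the choice is
immaterial. -/
theorem act_out (x : X) {e : P.carrier} (he : P.r e = π x) :
    act e (Quotient.mk (indistSetoid P π act) x).out = act e x := by
  have h : Indist P π act 1 (Quotient.mk (indistSetoid P π act) x).out x :=
    Quotient.mk_out (s := indistSetoid P π act) x
  exact h.2 e (he.trans h.1.symm)

theorem quotAct_mk (x : X) {e : P.carrier} (he : P.r e = π x) :
    quotAct P π act e (Quotient.mk _ x) = Quotient.mk _ (act e x) :=
  congrArg _ (act_out P π act x he)

variable {P π act}

theorem Indist.mk :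
    ∀ {k x y}, Indist P π act (k + 1) x y →
      Indist P (quotProj P π act) (quotAct P π act) k (Quotient.mk _ x) (Quotient.mk _ y)
  | 0, _, _, h => Quotient.sound h
  | k + 1, x, y, h => by
    refine ⟨h.1, fun e he => ?_⟩
    rw [quotAct_mk P π act x he, quotAct_mk P π act y (he.trans h.1)]
    exact Indist.mk (h.2 e he)

variable (P π act)

-- Columns of the cover's matrix at undistinguished points agree, so the matrix factors through the
-- quotient as these columns times the class indicator. In the opposite order the product adds up
-- the rows of each class, giving the matrix of the amalgamated cover.
open Classical in
theorem elementarySSE_quotient [Finite P.carrier] [Fintype X]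
    [Fintype (Quotient (indistSetoid P π act))] :
    ElementarySSE (adj (cover P π act))
      (adj (cover P (quotProj P π act) (quotAct P π act))) := by
  refine ⟨.of fun x q => Nat.card {e : P.carrier // P.r e = π q.out ∧ act e q.out = x},
    .of fun q x => if Quotient.mk _ x = q then 1 else 0, ?_, ?_⟩
  · ext x y
    rw [Matrix.mul_apply, adj_cover_apply]
    simp only [Matrix.of_apply, mul_ite, mul_one, mul_zero, Finset.sum_ite_eq,
      Finset.mem_univ, if_true]
    refine Nat.card_congr (Equiv.subtypeEquivRight fun e => ?_)
    rw [quotProj_out P π act]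
    exact and_congr_right fun he => by rw [act_out P π act y he]
  · ext q q'
    rw [Matrix.mul_apply, adj_cover_apply]
    have := Fintype.ofFinite P.carrier
    simp only [Matrix.of_apply, ite_mul, one_mul, zero_mul, Nat.card_eq_fintype_card,
      Fintype.card_subtype]
    rw [← Finset.sum_filter]
    -- Edges are sorted by the point of the class `q` to which they carry the representative of
    -- `q'`.
    rw [Finset.card_eq_sum_card_fiberwise (f := fun e => act e q'.out)
      (t := Finset.univ.filter fun x => Quotient.mk (indistSetoid P π act) x = q)]
    · refine Finset.sum_congr rfl fun x hx => congrArg _ ?_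
      ext e
      have hx := (Finset.mem_filter.1 hx).2
      simp only [Finset.mem_filter, Finset.mem_univ, true_and, quotProj_out]
      constructor
      · rintro ⟨h, rfl⟩
        exact ⟨⟨h, hx⟩, rfl⟩
      · rintro ⟨⟨h, -⟩, h'⟩
        exact ⟨h, h'⟩
    · intro e he
      exact Finset.mem_filter.2 ⟨Finset.mem_univ _, (Finset.mem_filter.1 he).2.2⟩

end Quotient

open Classical in
/-- Matrices that agree up to a bijection of the index sets are elementarily equivalent. -/
theorem elementarySSE_of_bijective {X : Type u} [Fintype X] [Fintype V] {M : Matrix X X ℕ}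
    {N : Matrix V V ℕ} {π : X → V} (hπ : π.Bijective) (h : ∀ x y, M x y = N (π x) (π y)) :
    ElementarySSE M N := by
  refine ⟨.of fun x v => N (π x) v, .of fun v x => if π x = v then 1 else 0, ?_, ?_⟩
  · ext x y
    simp [Matrix.mul_apply, h]
  · ext v w
    obtain ⟨x, rfl⟩ := hπ.2 v
    simp [Matrix.mul_apply, hπ.1.eq_iff]

/-- A cover of a finite graph on which long words act as constants is strong shift equivalent
to it. -/
theorem sse_cover (P : EdgeSet V V) [Finite P.carrier] [Fintype V] :
    ∀ (k : ℕ) {X : Type u} [Fintype X] (π : X → V) (act : P.carrier → X → X),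
      π.Surjective → (∀ e x, P.r e = π x → π (act e x) = P.s e) →
      (∀ x y, π x = π y → Indist P π act k x y) → SSE (adj (cover P π act)) (adj P)
  | 0, X, _, π, act, hs, hπ, hk => by
    -- For k = 0 each fibre is a single point, so the cover is the graph itself.
    refine (elementarySSE_of_bijective (π := π) ⟨hk, hs⟩ fun x y => ?_).sse
    rw [adj_cover_apply]
    refine Nat.card_congr (Equiv.subtypeEquivRight fun e => ?_)
    rw [and_comm]
    refine and_congr_left fun he => ⟨?_, fun h => hk _ _ ((hπ e y he).trans h)⟩
    rintro rfl
    exact (hπ e y he).symm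
  | k + 1, X, _, π, act, hs, hπ, hk => by
    have := Fintype.ofFinite (Quotient (indistSetoid P π act))
    -- Amalgamating once shortens by one the words needed to act as constants.
    refine (elementarySSE_quotient P π act).sse.trans
      (sse_cover P k (quotProj P π act) (quotAct P π act) ?_ ?_ ?_)
    · intro v
      obtain ⟨x, rfl⟩ := hs v
      exact ⟨Quotient.mk _ x, rfl⟩
    · intro e q he
      rw [← quotProj_out] at he
      exact hπ e _ he
    · intro p q
      induction p using Quotient.inductionOn
      induction q using Quotient.inductionOn
      exact fun h => (hk _ _ h).mk

end Covers

/-! ### From compatible shifts to strong shift equivalence -/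

section Williams

variable {V W : Type u}

/-- The reversed graph. -/
def op (P : EdgeSet V W) : EdgeSet W V where
  carrier := P.carrier
  s := P.r
  r := P.s

theorem adj_op (P : EdgeSet V W) : adj (op P) = (adj P).transpose := by
  ext w v
  exact Nat.card_congr (Equiv.subtypeEquivRight fun e => and_comm)

theorem adj_E (F : Matrix V W ℕ) : adj (E F) = F := by
  ext v w
  refine (Nat.card_congr (β := Fin (F v w))
    { toFun := fun e => Fin.cast (by obtain ⟨⟨_, _, _⟩, rfl, rfl⟩ := e; rfl) e.1.idx
      invFun := fun i => ⟨⟨v, w, i⟩, rfl, rfl⟩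
      left_inv := by rintro ⟨⟨_, _, _⟩, rfl, rfl⟩; rfl
      right_inv := fun _ => rfl }).trans (by simp)

instance [Finite V] [Finite W] (F : Matrix V W ℕ) : Finite (E F).carrier := by
  let f : V → W → ℕ := F
  refine Finite.of_injective (β := Σ v : V, Σ w : W, Fin (f v w))
    (fun e : Edge F => ⟨e.src, e.rng, e.idx⟩) ?_
  rintro ⟨v, w, i⟩ ⟨v', w', i'⟩ h
  cases h
  rfl

variable {A : EdgeSet V V} {B : EdgeSet W W} {R : EdgeSet V W} {S : EdgeSet W V} {m : ℕ}

open Classical in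
/-- The action of the edges of `A` on `R` given by `φ (a, x) = (act a x, b)`. -/
noncomputable def leftAct (φ : PathIso (fib A R) (fib R B)) (a : A.carrier) (x : R.carrier) :
    R.carrier :=
  if h : A.r a = R.s x then (φ.toEquiv ⟨(a, x), h⟩).1.1 else x

open Classical in
/-- The action of the edges of `B` on `R` given by `φ (a, act b x) = (x, b)`. -/
noncomputable def rightAct (φ : PathIso (fib A R) (fib R B)) (b : (op B).carrier)
    (x : R.carrier) : R.carrier :=
  if h : R.r x = B.s b then (φ.symm.toEquiv ⟨(x, b), h⟩).1.2 else x

variable {φ : PathIso (fib A R) (fib R B)}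

theorem exists_step_leftAct {a x} (h : A.r a = R.s x) : ∃ b, Step φ a x (leftAct φ a x) b := by
  rw [leftAct, dif_pos h]
  exact ⟨_, step_apply φ ⟨(a, x), h⟩⟩

theorem exists_step_rightAct {b x} (h : R.r x = B.s b) : ∃ a, Step φ a (rightAct φ b x) x b := by
  have e : rightAct φ b x = (φ.symm.toEquiv ⟨(x, b), h⟩).1.2 := dif_pos h
  rw [e]
  exact ⟨_, (φ.symm.toEquiv ⟨(x, b), h⟩).2, h, Equiv.apply_symm_apply _ _⟩

theorem leftAct_eq_iff {a x y} : A.r a = R.s x ∧ leftAct φ a x = y ↔ ∃ b, Step φ a x y b := by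
  refine ⟨?_, fun ⟨b, h⟩ => ⟨h.r_eq, ?_⟩⟩
  · rintro ⟨h, rfl⟩
    exact exists_step_leftAct h
  · obtain ⟨b', h'⟩ := exists_step_leftAct (φ := φ) h.r_eq
    exact (h'.right_unique h).1

theorem rightAct_eq_iff {b x y} :
    (op B).r b = R.r y ∧ rightAct φ b y = x ↔ ∃ a, Step φ a x y b := by
  refine ⟨?_, fun ⟨a, h⟩ => ⟨h.r_eq'.symm, ?_⟩⟩
  · rintro ⟨h, rfl⟩
    exact exists_step_rightAct h.symm
  · obtain ⟨a', h'⟩ := exists_step_rightAct (φ := φ) h.r_eq'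
    exact (h'.left_unique h).2

/-- Edges of either cover correspond to the solutions of φ(a, x) = (y, b), with opposite directions.
Once x and y are fixed, each of a and b determines the other. -/
theorem adj_cover_rightAct (φ : PathIso (fib A R) (fib R B)) :
    adj (cover (op B) R.r (rightAct φ)) = (adj (cover A R.s (leftAct φ))).transpose := by
  ext x y
  rw [Matrix.transpose_apply, adj_cover_apply, adj_cover_apply]
  refine Nat.card_congr ((Equiv.subtypeEquivRight fun b => rightAct_eq_iff).trans <|
    Equiv.trans ?_ (Equiv.subtypeEquivRight fun a => leftAct_eq_iff).symm)
  exact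
    { toFun := fun b => ⟨b.2.choose, b.1, b.2.choose_spec⟩
      invFun := fun a => ⟨a.2.choose, a.1, a.2.choose_spec⟩
      left_inv := fun b => Subtype.ext (Step.right_unique (Exists.choose_spec _) b.2.choose_spec).2
      right_inv := fun a => Subtype.ext (Step.left_unique
        (Exists.choose_spec (p := fun a' => Step φ a' x y a.2.choose) ⟨a.1, a.2.choose_spec⟩)
        a.2.choose_spec).1 }

/-- The edge acting first is the last letter of the word, hence `Run.snoc`; for the right action,
which undoes steps, it is the first letter, hence `Run.cons`. -/
theorem indist_leftAct : ∀ {k x y}, R.s x = R.s y →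
    (∀ l x' y' l' l'', l.length = k → Run φ l x x' l' → Run φ l y y' l'' → x' = y') →
    Indist A R.s (leftAct φ) k x y
  | 0, x, y, _, H => H _ _ _ _ _ rfl (.nil x) (.nil y)
  | k + 1, x, y, hxy, H => by
    refine ⟨hxy, fun e he => ?_⟩
    obtain ⟨b, h⟩ := exists_step_leftAct (φ := φ) he
    obtain ⟨b', h'⟩ := exists_step_leftAct (φ := φ) (he.trans hxy)
    refine indist_leftAct (h.s_eq.trans h'.s_eq.symm) fun l x' y' l' l'' hl h₁ h₂ => ?_
    exact H _ _ _ _ _ (by simp [hl]) (h₁.snoc h) (h₂.snoc h')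

theorem indist_rightAct : ∀ {k x y}, R.r x = R.r y →
    (∀ l l' x' y' l'', l''.length = k → Run φ l x' x l'' → Run φ l' y' y l'' → x' = y') →
    Indist (op B) R.r (rightAct φ) k x y
  | 0, x, y, _, H => H _ _ _ _ _ rfl (.nil x) (.nil y)
  | k + 1, x, y, hxy, H => by
    refine ⟨hxy, fun e he => ?_⟩
    obtain ⟨a, h⟩ := exists_step_rightAct (φ := φ) he.symm
    obtain ⟨a', h'⟩ := exists_step_rightAct (φ := φ) (he.trans hxy).symm
    refine indist_rightAct (h.s_eq'.symm.trans h'.s_eq') fun l l' x' y' l'' hl h₁ h₂ => ?_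
    exact H _ _ _ _ (_ :: l'') (congrArg Nat.succ hl) (h₁.cons h) (h₂.cons h')

/-- If φ⁽ᵐ⁾(w, z) = (x, w'), compatibility gives w = ψ(x, y) and w' = ψ'(y, z). So x depends on w
alone and z on w' alone: words of length m act as constants on the fibres of both covers. -/
theorem HalfCompatible.sse_adj [Fintype V] [Fintype W] [Finite A.carrier] [Finite B.carrier]
    [Finite R.carrier] {ψ : PathIso (fib R S) (pow A m)} {ψ' : PathIso (fib S R) (pow B m)}
    (hm : 0 < m) (H : HalfCompatible φ ψ ψ') (hs : ∀ v, ∃ x, R.s x = v)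
    (hr : ∀ w, ∃ x, R.r x = w) : SSE (adj A) (adj B) := by
  have := Fintype.ofFinite R.carrier
  have : Finite (op B).carrier := ‹Finite B.carrier›
  have step : ∀ {w z x w'}, Step (φ.iter m) w z x w' →
      ∃ y, Joins ψ x y w ∧ Joins ψ' y z w' := by
    intro w z x w' h
    rw [H] at h
    exact h.exists_joins
  have hL : SSE (adj (cover A R.s (leftAct φ))) (adj A) := by
    refine sse_cover A m R.s (leftAct φ) hs (fun e x he => ?_) fun x y hxy => ?_
    · obtain ⟨b, h⟩ := exists_step_leftAct (φ := φ) he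
      exact h.s_eq
    · refine indist_leftAct hxy fun l x' y' l' l'' hl h h' => ?_
      obtain ⟨w, w', e, -, hw⟩ := h.exists_step_iter hl
      obtain ⟨w₁, w₁', e₁, -, hw₁⟩ := h'.exists_step_iter hl
      obtain rfl := word_injective_of_pos hm (e.trans e₁.symm)
      obtain ⟨_, j, -⟩ := step hw
      obtain ⟨_, j', -⟩ := step hw₁
      exact (j.left_unique j').1
  have hR : SSE (adj (cover (op B) R.r (rightAct φ))) (adj (op B)) := by
    refine sse_cover (op B) m R.r (rightAct φ) hr (fun e x he => ?_) fun x y hxy => ?_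
    · obtain ⟨a, h⟩ := exists_step_rightAct (φ := φ) he.symm
      exact h.s_eq'.symm
    · refine indist_rightAct hxy fun l l' x' y' l'' hl h h' => ?_
      obtain ⟨w, w', -, e, hw⟩ := h.exists_step_iter (h.length_eq.symm.trans hl)
      obtain ⟨w₁, w₁', -, e₁, hw₁⟩ := h'.exists_step_iter (h'.length_eq.symm.trans hl)
      obtain rfl := word_injective_of_pos hm (e.trans e₁.symm)
      obtain ⟨_, -, j⟩ := step hw
      obtain ⟨_, -, j'⟩ := step hw₁
      exact (j.left_unique j').2
  rw [adj_cover_rightAct, adj_op] at hR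
  obtain ⟨n, hR⟩ := hR
  exact hL.symm.trans ⟨n, by simpa using hR.transpose⟩

theorem CompatibleLag.sse [Fintype V] [Fintype W] {A : Matrix V V ℕ} {B : Matrix W W ℕ}
    (hA : Essential A) (hB : Essential B) (hm : 0 < m) (h : CompatibleLag A B m) : SSE A B := by
  obtain ⟨c, h, -⟩ := h
  have := HalfCompatible.sse_adj hm h (exists_left_s_eq c.ψA hA.exists_s_eq)
    (exists_right_r_eq c.ψB hB.exists_r_eq)
  rwa [adj_E, adj_E] at this

end Williams

/-! ### Composing exchanges along a chain -/

section Compose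

variable {V U W : Type u} {A : EdgeSet V V} {C : EdgeSet U U} {B : EdgeSet W W}
  {R₁ : EdgeSet V U} {S₁ : EdgeSet U V} {R : EdgeSet U W} {S : EdgeSet W U} {m : ℕ}

/-- Moving a product `R₁ × R` across an edge, one factor at a time. -/
def pasteStep (φ₁ : PathIso (fib A R₁) (fib R₁ C)) (φ : PathIso (fib C R) (fib R B)) :
    PathIso (fib A (fib R₁ R)) (fib (fib R₁ R) B) :=
  (assoc A R₁ R).symm.trans <| (φ₁.prod (refl R)).trans <| (assoc R₁ C R).trans <|
    ((refl R₁).prod φ).trans (assoc R₁ R B).symm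

theorem Step.exists_of_pasteStep {φ₁ : PathIso (fib A R₁) (fib R₁ C)}
    {φ : PathIso (fib C R) (fib R B)} {a p q b} (h : Step (pasteStep φ₁ φ) a p q b) :
    ∃ c, Step φ₁ a p.1.1 q.1.1 c ∧ Step φ c p.1.2 q.1.2 b := by
  obtain ⟨h, h', e⟩ := h
  obtain ⟨y, c, h₁⟩ := exists_step φ₁ (a := a) (x := p.1.1) h
  obtain ⟨z, d, h₂⟩ := exists_step φ (a := c) (x := p.1.2) (h₁.s_eq'.trans p.2)
  obtain ⟨i₁, i₂, e₁⟩ := id h₁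
  obtain ⟨i₃, i₄, e₂⟩ := id h₂
  have e₃ : (φ₁.prod (refl R)).toEquiv ⟨(⟨(a, p.1.1), i₁⟩, p.1.2), p.2⟩ =
      ⟨(⟨(y, c), i₂⟩, p.1.2), i₃⟩ := Subtype.ext (Prod.ext e₁ rfl)
  have e₄ : ((refl R₁).prod φ).toEquiv ⟨(y, ⟨(c, p.1.2), i₃⟩), i₂⟩ =
      ⟨(y, ⟨(z, d), i₄⟩), i₂.trans h₂.s_eq.symm⟩ := Subtype.ext (Prod.ext rfl e₂)
  have e₅ := e.symm.trans <| (congrArg ((assoc R₁ C R).trans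
    (((refl R₁).prod φ).trans (assoc R₁ R B).symm)).toEquiv e₃).trans
      (congrArg (assoc R₁ R B).symm.toEquiv e₄)
  have e₆ : q.1.1 = y := congrArg (fun t => t.1.1.1.1) e₅
  have e₇ : q.1.2 = z := congrArg (fun t => t.1.1.1.2) e₅
  have e₈ : b = d := congrArg (fun t => t.1.2) e₅
  rw [e₆, e₇, e₈]
  exact ⟨c, h₁, h₂⟩

/-- The re-bracketing `R₁ (S₁ R₁)ᵐ S₁ = (R₁ S₁)ᵐ⁺¹`, for `A = R₁ S₁` and `C = S₁ R₁`. -/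
def zigzag (α : PathIso (fib R₁ S₁) A) (γ : PathIso (fib S₁ R₁) C) :
    (m : ℕ) → PathIso (fib R₁ (fib (pow C m) S₁)) (pow A (m + 1))
  | 0 => ((refl R₁).prod (leftUnit S₁)).trans (α.trans (rightUnit A).symm)
  | m + 1 =>
    ((refl R₁).prod ((assoc C (pow C m) S₁).trans
      ((γ.symm.prod (refl (fib (pow C m) S₁))).trans
        (assoc S₁ R₁ (fib (pow C m) S₁))))).trans <|
      (assoc R₁ S₁ (fib R₁ (fib (pow C m) S₁))).symm.trans (α.prod (zigzag α γ m))

/-- The relation that `x l y` re-brackets to `l'`, on lists of edges. -/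
inductive Zigzag (α : PathIso (fib R₁ S₁) A) (γ : PathIso (fib S₁ R₁) C) :
    R₁.carrier → List C.carrier → S₁.carrier → List A.carrier → Prop
  | nil {x y a} : Joins α x y a → Zigzag α γ x [] y [a]
  | cons {x y' a x' c l y l'} : Joins α x y' a → Joins γ y' x' c → Zigzag α γ x' l y l' →
      Zigzag α γ x (c :: l) y (a :: l')

variable {α : PathIso (fib R₁ S₁) A} {γ : PathIso (fib S₁ R₁) C}

theorem zigzag_apply (α : PathIso (fib R₁ S₁) A) (γ : PathIso (fib S₁ R₁) C) :
    ∀ {m : ℕ} (p : (fib R₁ (fib (pow C m) S₁)).carrier),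
      Zigzag α γ p.1.1 (word p.1.2.1.1) p.1.2.1.2 (word ((zigzag α γ m).toEquiv p))
  | 0, ⟨(x, ⟨(v, y), h⟩), h'⟩ => .nil (joins_apply α ⟨(x, y), h'.trans h⟩)
  | m + 1, ⟨(x, ⟨(⟨(c, w), h⟩, y), h'⟩), h''⟩ => by
    obtain ⟨y', x', j⟩ := exists_joins_symm γ c
    obtain ⟨a, j'⟩ := exists_joins α (h''.trans j.s_eq)
    have h₁ : R₁.r x' = (pow C m).s w := j.r_eq'.symm.trans h
    have ih := zigzag_apply α γ ⟨(x', ⟨(w, y), h'⟩), h₁⟩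
    have e : ((refl R₁).prod ((assoc C (pow C m) S₁).trans
        ((γ.symm.prod (refl (fib (pow C m) S₁))).trans
          (assoc S₁ R₁ (fib (pow C m) S₁))))).toEquiv ⟨(x, ⟨(⟨(c, w), h⟩, y), h'⟩), h''⟩ =
        ⟨(x, ⟨(y', ⟨(x', ⟨(w, y), h'⟩), h₁⟩), j.1⟩), j'.1⟩ := by
      have : (γ.symm.prod (refl (fib (pow C m) S₁))).toEquiv ⟨(c, ⟨(w, y), h'⟩), h⟩ =
        ⟨(⟨(y', x'), j.1⟩, ⟨(w, y), h'⟩), h₁⟩ := Subtype.ext (Prod.ext j.symm_apply rfl)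
      exact Subtype.ext (Prod.ext rfl
        (congrArg (assoc S₁ R₁ (fib (pow C m) S₁)).toEquiv this))
    have e' := congrArg ((assoc R₁ S₁ (fib R₁ (fib (pow C m) S₁))).symm.trans
      (α.prod (zigzag α γ m))).toEquiv e
    have key := Zigzag.cons j' j ih
    rw [← j'.2] at key
    have e₁ := congrArg (fun q : (pow A (m + 2)).carrier => word q) e'
    exact e₁ ▸ key

theorem Zigzag.snoc {x l y l' c x' y' a} (h : Zigzag α γ x l y l') (j : Joins γ y x' c)
    (j' : Joins α x' y' a) : Zigzag α γ x (l ++ [c]) y' (l' ++ [a]) := by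
  induction h with
  | nil i => exact .cons i j (.nil j')
  | cons i i' _ ih => exact .cons i i' (ih j)

theorem Zigzag.unique {x l y l' l''} (h : Zigzag α γ x l y l') (h' : Zigzag α γ x l y l'') :
    l' = l'' := by
  induction h generalizing l'' with
  | nil j =>
    cases h' with
    | nil j' => rw [j.right_unique j']
  | cons j i _ ih =>
    cases h' with
    | cons j₁ i₁ h₁ =>
      obtain ⟨rfl, rfl⟩ := i.left_unique i₁
      rw [j.right_unique j₁, ih h₁]

/-- The window isomorphism of a composed shift. -/
def pasteWindow (α : PathIso (fib R₁ S₁) A) (γ : PathIso (fib S₁ R₁) C)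
    (ψ : PathIso (fib R S) (pow C m)) :
    PathIso (fib (fib R₁ R) (fib S S₁)) (pow A (m + 1)) :=
  (assoc R₁ R (fib S S₁)).trans <|
    ((refl R₁).prod ((assoc R S S₁).symm.trans (ψ.prod (refl S₁)))).trans (zigzag α γ m)

theorem Joins.exists_of_pasteWindow {ψ : PathIso (fib R S) (pow C m)} {p q w}
    (j : Joins (pasteWindow α γ ψ) p q w) :
    ∃ u, Joins ψ p.1.2 q.1.1 u ∧ Zigzag α γ p.1.1 (word u) q.1.2 (word w) := by
  obtain ⟨h, rfl⟩ := j
  exact ⟨_, ⟨h, rfl⟩, zigzag_apply α γ (((refl R₁).prod ((assoc R S S₁).symm.trans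
    (ψ.prod (refl S₁)))).toEquiv ((assoc R₁ R (fib S S₁)).toEquiv ⟨(p, q), h⟩))⟩

/-- Prefixing the step over `a` to the zigzag of the old window, and suffixing the step producing
`a'` to that of the new window, gives zigzags with the same ends. Their C-words agree by alignment
of the inner shift, so their A-words agree too. -/
theorem HalfAligned.paste {φ : PathIso (fib C R) (fib R B)} {φ' : PathIso (fib B S) (fib S C)}
    {ψ : PathIso (fib R S) (pow C m)} (H : HalfAligned φ φ' ψ) (α : PathIso (fib R₁ S₁) A)
    (γ : PathIso (fib S₁ R₁) C) :
    HalfAligned (pasteStep (exchange α γ) φ) (pasteStep φ' (exchange γ α))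
      (pasteWindow α γ ψ) := by
  refine halfAligned_iff.2 fun a x y x' b y' a' w w' h h' j j' => ?_
  obtain ⟨c, h₁, h₂⟩ := h.exists_of_pasteStep
  obtain ⟨c', h₁', h₂'⟩ := h'.exists_of_pasteStep
  obtain ⟨s, i₁, i₂⟩ := h₁.exists_joins
  obtain ⟨r, i₃, i₄⟩ := h₂'.exists_joins
  obtain ⟨u, k, z⟩ := j.exists_of_pasteWindow
  obtain ⟨u', k', z'⟩ := j'.exists_of_pasteWindow
  have e := halfAligned_iff.1 H _ _ _ _ _ _ _ _ _ h₂ h₁' k k'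
  have z₁ := Zigzag.cons i₁ i₂ z
  rw [e] at z₁
  exact z₁.unique (z'.snoc i₃ i₄)

/-- There is a concrete shift of lag `m` between the graphs `A` and `B` whose first half is
aligned, given by finite sets of edges. -/
def HalfAlignedLag (A : EdgeSet V V) (B : EdgeSet W W) (m : ℕ) : Prop :=
  ∃ (R : EdgeSet V W) (S : EdgeSet W V) (φ : PathIso (fib A R) (fib R B))
    (φ' : PathIso (fib B S) (fib S A)) (ψ : PathIso (fib R S) (pow A m)),
    Finite R.carrier ∧ Finite S.carrier ∧ Nonempty (PathIso (fib S R) (pow B m)) ∧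
      HalfAligned φ φ' ψ

theorem finite_fib {P : EdgeSet V U} {Q : EdgeSet U W} [Finite P.carrier] [Finite Q.carrier] :
    Finite (fib P Q).carrier :=
  inferInstanceAs (Finite {p : P.carrier × Q.carrier // P.r p.1 = Q.s p.2})

/-- Starting the induction at lag 0 makes a single elementary equivalence an instance of the general
step. -/
theorem HalfAlignedLag.zero [Finite W] (B : EdgeSet W W) : HalfAlignedLag B B 0 := by
  have : Finite (vertices W).carrier := ‹Finite W›
  refine ⟨vertices W, vertices W, (rightUnit B).trans (leftUnit B).symm,
    (rightUnit B).trans (leftUnit B).symm, leftUnit (vertices W), this, this,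
    ⟨leftUnit (vertices W)⟩, halfAligned_iff.2 ?_⟩
  rintro a x y x' b y' a' l l' ⟨_, _, e⟩ ⟨_, _, e'⟩ - -
  have e₁ : a = b := congrArg (fun q => q.1.2) e
  have e₂ : b = a' := congrArg (fun q => q.1.2) e'
  rw [e₁, e₂]
  rfl

theorem HalfAlignedLag.succ [Finite R₁.carrier] [Finite S₁.carrier]
    (α : PathIso (fib R₁ S₁) A) (γ : PathIso (fib S₁ R₁) C) (h : HalfAlignedLag C B m) :
    HalfAlignedLag A B (m + 1) := by
  obtain ⟨R, S, φ, φ', ψ, _, _, ⟨ψ'⟩, H⟩ := h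
  refine ⟨fib R₁ R, fib S S₁, _, _, _, finite_fib, finite_fib, ⟨?_⟩, H.paste α γ⟩
  -- S S₁ R₁ R → S C R → S R B → Bᵐ B → Bᵐ⁺¹. No alignment of this isomorphism is needed, since it
  -- is replaced later.
  exact (assoc S S₁ (fib R₁ R)).trans <|
    ((refl S).prod ((assoc S₁ R₁ R).symm.trans ((γ.prod (refl R)).trans φ))).trans <|
      (assoc S R B).symm.trans ((ψ'.prod (refl B)).trans (rebracket B m).symm)

end Compose

/-! ### From edge sets back to matrices -/

section Realize

variable {V U W : Type u}

theorem adj_fib [Fintype U] (P : EdgeSet V U) (Q : EdgeSet U W) [Finite P.carrier]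
    [Finite Q.carrier] : adj (fib P Q) = adj P * adj Q := by
  ext v w
  rw [Matrix.mul_apply]
  simp only [adj]
  simp only [← Nat.card_prod]
  rw [← Nat.card_sigma]
  exact Nat.card_congr
    { toFun := fun p => ⟨P.r p.1.1.1, ⟨p.1.1.1, p.2.1, rfl⟩, ⟨p.1.1.2, p.1.2.symm, p.2.2⟩⟩
      invFun := fun q => ⟨⟨(q.2.1.1, q.2.2.1), q.2.1.2.2.trans q.2.2.2.1.symm⟩,
        q.2.1.2.1, q.2.2.2.2⟩
      left_inv := fun _ => rfl
      right_inv := by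
        rintro ⟨_, ⟨e, h, rfl⟩, ⟨f, h', h''⟩⟩
        rfl }

/-- Path isomorphisms are arbitrary bijections between the edges joining each pair of vertices, so
equality of the counts is enough. -/
theorem nonempty_pathIso_E (P : EdgeSet V W) [Finite P.carrier] {F : Matrix V W ℕ}
    (h : adj P = F) : Nonempty (PathIso P (E F)) := by
  have f : ∀ v w, {e : P.carrier // P.s e = v ∧ P.r e = w} ≃ Fin (F v w) := fun v w =>
    Finite.equivFinOfCardEq (congrFun (congrFun h v) w)
  let g : P.carrier → Edge F := fun e => ⟨P.s e, P.r e, f _ _ ⟨e, rfl, rfl⟩⟩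
  exact ⟨{
    toEquiv :=
      { toFun := g
        invFun := fun x => ((f _ _).symm x.idx).1
        left_inv := fun e => congrArg Subtype.val ((f _ _).symm_apply_apply ⟨e, rfl, rfl⟩)
        right_inv := by
          rintro ⟨v, w, i⟩
          obtain ⟨⟨e, rfl, rfl⟩, rfl⟩ := (f v w).surjective i
          exact congrArg (fun z => g z.1) ((f _ _).symm_apply_apply ⟨e, rfl, rfl⟩) }
    map_s := fun _ => rfl
    map_r := fun _ => rfl }⟩

theorem SSELag.halfAlignedLag {m : ℕ} [Fintype V] [Fintype W] {A : Matrix V V ℕ}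
    {B : Matrix W W ℕ} (h : SSELag m A B) : HalfAlignedLag (E A) (E B) m := by
  have step : ∀ {m : ℕ} {V U W : Type u} [Fintype V] [Fintype U] [Fintype W]
      {A : Matrix V V ℕ} {C : Matrix U U ℕ} {B : Matrix W W ℕ}, ElementarySSE A C →
      HalfAlignedLag (E C) (E B) m → HalfAlignedLag (E A) (E B) (m + 1) := by
    rintro m V U W _ _ _ A C B ⟨R, S, hA, hC⟩ h
    have := finite_fib (P := E R) (Q := E S)
    have := finite_fib (P := E S) (Q := E R)
    obtain ⟨α⟩ := nonempty_pathIso_E (fib (E R) (E S)) (F := A) (by rw [adj_fib, adj_E, adj_E, hA])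
    obtain ⟨γ⟩ := nonempty_pathIso_E (fib (E S) (E R)) (F := C) (by rw [adj_fib, adj_E, adj_E, hC])
    exact h.succ α γ
  induction h with
  | single h => exact step h (.zero _)
  | cons h _ ih => exact step h ih

/-- Transport of `φ` along an isomorphism `ρ`. -/
def conjStep {A : EdgeSet V V} {B : EdgeSet W W} {R R' : EdgeSet V W}
    (φ : PathIso (fib A R) (fib R B)) (ρ : PathIso R R') : PathIso (fib A R') (fib R' B) :=
  ((refl A).prod ρ.symm).trans (φ.trans (ρ.prod (refl B)))

theorem Step.of_conjStep {A : EdgeSet V V} {B : EdgeSet W W} {R R' : EdgeSet V W}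
    {φ : PathIso (fib A R) (fib R B)} {ρ : PathIso R R'} {a x y b}
    (h : Step (conjStep φ ρ) a x y b) :
    Step φ a (ρ.symm.toEquiv x) (ρ.symm.toEquiv y) b := by
  obtain ⟨h, h', e⟩ := h
  refine ⟨h.trans (ρ.symm.map_s x).symm, (ρ.symm.map_r y).trans h', ?_⟩
  exact (ρ.prod (refl B)).toEquiv.injective (e.trans
    (Subtype.ext (Prod.ext (ρ.toEquiv.apply_symm_apply y).symm rfl)))

/-- Composition produces fibered products, which are not literally edge sets of matrices. Finiteness
lets them be relabelled as such, and alignment survives conjugation by the relabelling. -/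
theorem HalfAlignedLag.exists_concreteShift {m : ℕ} {A : Matrix V V ℕ} {B : Matrix W W ℕ}
    (h : HalfAlignedLag (E A) (E B) m) :
    ∃ c : ConcreteShift A B m, HalfAligned c.φR c.φS c.ψA := by
  obtain ⟨R, S, φ, φ', ψ, _, _, ⟨ψ'⟩, H⟩ := h
  obtain ⟨ρ⟩ := nonempty_pathIso_E R rfl
  obtain ⟨σ⟩ := nonempty_pathIso_E S rfl
  refine ⟨⟨adj R, adj S,
    conjStep φ ρ, conjStep φ' σ,
    (ρ.symm.prod σ.symm).trans ψ, (σ.symm.prod ρ.symm).trans ψ'⟩, halfAligned_iff.2 ?_⟩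
  rintro a x y x' b y' a' l l' h h' ⟨h₁, e₁⟩ ⟨h₂, e₂⟩
  exact halfAligned_iff.1 H _ _ _ _ _ _ _ _ _ h.of_conjStep h'.of_conjStep
    ⟨(ρ.symm.map_r x).trans (h₁.trans (σ.symm.map_s y).symm), e₁⟩
    ⟨(ρ.symm.map_r x').trans (h₂.trans (σ.symm.map_s y').symm), e₂⟩

theorem SSELag.compatibleLag {m : ℕ} [Fintype V] [Fintype W] {A : Matrix V V ℕ}
    {B : Matrix W W ℕ} (hB : Essential B) (h : SSELag m A B) : CompatibleLag A B m := by
  obtain ⟨c, hc⟩ := h.halfAlignedLag.exists_concreteShift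
  exact c.compatibleLag_of_halfBalanced hB (hc.halfBalanced h.pos)

end Realize
end ShiftEq

theorem theoremA {V W : Type u} (A : Matrix V V ℕ) (B : Matrix W W ℕ)
    (hA : ShiftEq.Essential A) (hB : ShiftEq.Essential B) :
    (∀ m : ℕ, 0 < m →
      (ShiftEq.AlignedLag A B m ↔ ShiftEq.BalancedLag A B m) ∧
      (ShiftEq.BalancedLag A B m ↔ ShiftEq.CompatibleLag A B m)) ∧
    (∀ [Fintype V] [Fintype W],
      (ShiftEq.Aligned A B ↔ ShiftEq.SSE A B) ∧
      (ShiftEq.Balanced A B ↔ ShiftEq.SSE A B) ∧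
      (ShiftEq.Compatible A B ↔ ShiftEq.SSE A B)) := by
  have key : ∀ m : ℕ, 0 < m →
      (ShiftEq.AlignedLag A B m ↔ ShiftEq.BalancedLag A B m) ∧
      (ShiftEq.BalancedLag A B m ↔ ShiftEq.CompatibleLag A B m) := fun m hm =>
    ⟨ShiftEq.alignedLag_iff_balancedLag hA hB hm, ShiftEq.balancedLag_iff_compatibleLag hB⟩
  refine ⟨key, fun {_ _} => ?_⟩
  have hC : ShiftEq.Compatible A B ↔ ShiftEq.SSE A B :=
    ⟨fun ⟨_, hm, h⟩ => h.sse hA hB hm, fun ⟨m, h⟩ => ⟨m, h.pos, h.compatibleLag hB⟩⟩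
  have hBC : ShiftEq.Balanced A B ↔ ShiftEq.Compatible A B :=
    exists_congr fun m => and_congr_right fun hm => (key m hm).2
  have hAB : ShiftEq.Aligned A B ↔ ShiftEq.Balanced A B :=
    exists_congr fun m => and_congr_right fun hm => (key m hm).1
  exact ⟨hAB.trans (hBC.trans hC), hBC.trans hC, hC⟩
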